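/- For a finite directed graph $G=(V,E)$ without loops or parallel edges, with $n=|V|\ge 1$ and $m=|E|$, let $R(v)$ be the set of vertices reachable from $v$ (including $v$), let $r(v)=|R(v)|$, and let $d(v,w)$ be the number of edges of a shortest path from $v$ to $w$. The closeness centrality (Lin's index) of $v$ is $$c(v)=\frac{(r(v)-1)^2}{(n-1)\sum_{w\in R(v)}d(v,w)},$$ with $c(v)=0$ if $r(v)=1$. A most closeness-central vertex is one that maximizes $c$. The Strong Exponential Time Hypothesis (SETH) says that for every constant $0<\delta<1$ there is a $k$ such that the $k$-satisfiability problem (is a given set of clauses, with at most $k$ literals each, in $N$ Boolean variables satisfiable?) cannot be decided in time $O((2-\delta)^N)$. Algorithms are deterministic and run on a random access machine with logarithmic cost (each elementary step costs the total bit length of the numbers and addresses that it handles); a graph is given by $n$, $m$ and the list of its edges in an arbitrary order. Suppose that for some $\varepsilon>0$ there is an algorithm that computes a most closeness-central vertex of every directed graph in worst-case time $O((n+m)^{2-\varepsilon})$ (which is $O(m^{2-\varepsilon})$ under the usual convention $n=O(m)$). Then SETH is false. The same conclusion holds if the input is restricted to sparse graphs: for every constant $C>0$, if for some $\varepsilon>0$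 there is an algorithm that computes a most closeness-central vertex in worst-case time $O((n+m)^{2-\varepsilon})$ on all directed graphs with $m\le C n$, then SETH is false. -/

import Mathlib

/-! ## Random access machines with logarithmic cost

A machine has registers and arrays, each indexed by the natural numbers, that hold natural
numbers. A program names its registers and arrays statically, so it uses finitely many of them,
and it reads and writes array cells at addresses that it computes. Every elementary step costs
one plus the binary lengths of the numbers it handles, addresses included. -/

namespace RAM

/-- The arithmetic operations: sum, truncated difference, product, integer quotient. -/
inductive Op where
  | add
  | sub
  | mul
  | div

/-- The value of an arithmetic operation. -/
def Op.eval : Op → ℕ → ℕ → ℕ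
  | .add, a, b => a + b
  | .sub, a, b => a - b
  | .mul, a, b => a * b
  | .div, a, b => a / b

/-- Programs. -/
inductive Prog where
  /-- do nothing -/
  | skip
  /-- `const r c`: put the number `c` into register `r` -/
  | const (r c : ℕ)
  /-- `op o r a b`: put the value of `o` at registers `a`, `b` into register `r` -/
  | op (o : Op) (r a b : ℕ)
  /-- `load r j a`: put the cell of array `j` whose address is in register `a` into register `r` -/
  | load (r j a : ℕ)
  /-- `store j a b`: put register `b` into the cell of array `j` whose address is in register `a` -/
  | store (j a b : ℕ)
  /-- run `p`, then `q` -/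
  | seq (p q : Prog)
  /-- run `p` if register `a` is nonzero, otherwise run `q` -/
  | ite (a : ℕ) (p q : Prog)
  /-- run `p` as long as register `a` is nonzero -/
  | loop (a : ℕ) (p : Prog)

/-- The contents of the registers and of the arrays. -/
@[ext]
structure State where
  /-- `reg r` is the content of register `r` -/
  reg : ℕ → ℕ
  /-- `mem j i` is the content of cell `i` of array `j` -/
  mem : ℕ → ℕ → ℕ

/-- Overwrite register `r`. -/
def State.setReg (s : State) (r x : ℕ) : State :=
  { s with reg := Function.update s.reg r x }

/-- Overwrite cell `i` of array `j`. -/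
def State.setMem (s : State) (j i x : ℕ) : State :=
  { s with mem := Function.update s.mem j (Function.update (s.mem j) i x) }

/-- `Exec p s s' t`: started in state `s`, the program `p` halts in state `s'`, at total cost `t`.
`Nat.size x` is the number of binary digits of `x`. -/
inductive Exec : Prog → State → State → ℕ → Prop where
  | skip (s : State) : Exec .skip s s 1
  | const (s : State) (r c : ℕ) : Exec (.const r c) s (s.setReg r c) (1 + Nat.size c)
  | op (s : State) (o : Op) (r a b : ℕ) :
      Exec (.op o r a b) s (s.setReg r (o.eval (s.reg a) (s.reg b)))
        (1 + Nat.size (s.reg a) + Nat.size (s.reg b))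
  | load (s : State) (r j a : ℕ) :
      Exec (.load r j a) s (s.setReg r (s.mem j (s.reg a)))
        (1 + Nat.size (s.reg a) + Nat.size (s.mem j (s.reg a)))
  | store (s : State) (j a b : ℕ) :
      Exec (.store j a b) s (s.setMem j (s.reg a) (s.reg b))
        (1 + Nat.size (s.reg a) + Nat.size (s.reg b))
  | seq {p q : Prog} {s s' s'' : State} {t t' : ℕ} :
      Exec p s s' t → Exec q s' s'' t' → Exec (.seq p q) s s'' (t + t')
  | iteTrue {a : ℕ} {p q : Prog} {s s' : State} {t : ℕ} :
      s.reg a ≠ 0 → Exec p s s' t → Exec (.ite a p q) s s' (1 + Nat.size (s.reg a) + t)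
  | iteFalse {a : ℕ} {p q : Prog} {s s' : State} {t : ℕ} :
      s.reg a = 0 → Exec q s s' t → Exec (.ite a p q) s s' (1 + t)
  | loopDone {a : ℕ} {p : Prog} {s : State} :
      s.reg a = 0 → Exec (.loop a p) s s 1
  | loopStep {a : ℕ} {p : Prog} {s s' s'' : State} {t t' : ℕ} :
      s.reg a ≠ 0 → Exec p s s' t → Exec (.loop a p) s' s'' t' →
      Exec (.loop a p) s s'' (1 + Nat.size (s.reg a) + t + t')

/-- The initial state on an input word: the word is in array `0`, from cell `0` on, and all other
cells and all registers are zero. -/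
def init (l : List ℕ) : State where
  reg := fun _ => 0
  mem := fun j i => if j = 0 then l.getD i 0 else 0

end RAM

/-! ## Satisfiability and the strong exponential time hypothesis -/

/-- A clause on the variables `0, …, N - 1`: the literal `(i, true)` is the variable `i`, and
`(i, false)` is its negation. -/
abbrev SatClause (N : ℕ) := List (Fin N × Bool)

/-- `IsKCNF k φ`: the list `φ` of clauses is a `k`-CNF formula, that is, it lists a set of clauses,
each with at most `k` literals. -/
def IsKCNF {N : ℕ} (k : ℕ) (φ : List (SatClause N)) : Prop :=
  φ.Nodup ∧ ∀ C ∈ φ, C.length ≤ k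

/-- Some assignment of truth values makes a literal of every clause true. -/
def IsSatisfiable {N : ℕ} (φ : List (SatClause N)) : Prop :=
  ∃ x : Fin N → Bool, ∀ C ∈ φ, ∃ l ∈ C, x l.1 = l.2

/-- The formula as an input word: the number of variables, the number of clauses, then each clause,
as its length followed by its literals. -/
def encodeFormula {N : ℕ} (φ : List (SatClause N)) : List ℕ :=
  N :: φ.length :: φ.flatMap fun C => C.length :: C.map fun l => 2 * (l.1 : ℕ) + l.2.toNat

/-- `k`-satisfiability of formulas in `N` variables is decided by a program in time `O(T N)`; the
answer is left in register `0`. -/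
def KSatDecidableInTime (k : ℕ) (T : ℕ → ℝ) : Prop :=
  ∃ (p : RAM.Prog) (K : ℝ), ∀ (N : ℕ) (φ : List (SatClause N)), IsKCNF k φ →
    ∃ (s : RAM.State) (t : ℕ), RAM.Exec p (RAM.init (encodeFormula φ)) s t ∧
      (IsSatisfiable φ → s.reg 0 = 1) ∧ (¬ IsSatisfiable φ → s.reg 0 = 0) ∧
      (t : ℝ) ≤ K * T N

/-- The strong exponential time hypothesis: for no constant `δ > 0` can `k`-satisfiability be
decided in time `O((2 - δ) ^ N)` for every `k`. -/
def SETH : Prop :=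
  ∀ δ : ℝ, 0 < δ → δ < 1 → ∃ k : ℕ, ¬ KSatDecidableInTime k fun N => (2 - δ) ^ N

/-! ## Closeness centrality in directed graphs -/

namespace Digraph

variable {V : Type*}

/-- There is a walk with `k` edges from the first vertex to the second one. -/
def HasWalk (G : Digraph V) : ℕ → V → V → Prop
  | 0, v, w => v = w
  | k + 1, v, w => ∃ u, G.Adj v u ∧ G.HasWalk k u w

/-- The vertex `w` is reachable from `v`; every vertex is reachable from itself. -/
def Reaches (G : Digraph V) (v w : V) : Prop := ∃ k, G.HasWalk k v w

/-- The number of edges in a shortest path from `v` to `w`, used only if `w` is reachable. -/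
noncomputable def dist (G : Digraph V) (v w : V) : ℕ := sInf {k | G.HasWalk k v w}

open Classical in
/-- The set of vertices reachable from `v`. -/
noncomputable def reachSet [Fintype V] (G : Digraph V) (v : V) : Finset V :=
  Finset.univ.filter fun w => G.Reaches v w

/-- The closeness centrality (Lin's index) `(r - 1) ^ 2 / ((n - 1) * ∑ w, d(v, w))` of `v`, where
`w` ranges over the `r` vertices reachable from `v`. It is `0` if `r = 1`, when the fraction
reads `0 / 0`. -/
noncomputable def closeness [Fintype V] (G : Digraph V) (v : V) : ℚ :=
  (((G.reachSet v).card : ℚ) - 1) ^ 2 /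
    (((Fintype.card V : ℚ) - 1) * ∑ w ∈ G.reachSet v, (G.dist v w : ℚ))

/-- `v` is a vertex of maximum closeness centrality. -/
def IsMostCentral [Fintype V] (G : Digraph V) (v : V) : Prop :=
  ∀ w, G.closeness w ≤ G.closeness v

/-- `E` lists the edges of `G`, in some order, without repetition. -/
def IsEdgeList (G : Digraph V) (E : List (V × V)) : Prop :=
  E.Nodup ∧ ∀ v w, (v, w) ∈ E ↔ G.Adj v w

end Digraph

/-- A directed graph on `0, …, n - 1` as an input word: the number of vertices, the number of
edges, then the edges, each as its tail followed by its head. -/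
def encodeDigraph {n : ℕ} (E : List (Fin n × Fin n)) : List ℕ :=
  n :: E.length :: E.flatMap fun e => [(e.1 : ℕ), (e.2 : ℕ)]

/-- A program computes a most closeness-central vertex, in time `O((n + m) ^ a)`, on every
nonempty loopless directed graph whose numbers `n` of vertices and `m` of edges satisfy `𝒢 n m`;
the vertex is left in register `0`. -/
def MostCentralComputableInTime (𝒢 : ℕ → ℕ → Prop) (a : ℝ) : Prop :=
  ∃ (p : RAM.Prog) (K : ℝ), ∀ (n : ℕ) (G : Digraph (Fin n)) (E : List (Fin n × Fin n)),
    0 < n → (∀ v, ¬ G.Adj v v) → G.IsEdgeList E → 𝒢 n E.length →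
    ∃ (s : RAM.State) (t : ℕ), RAM.Exec p (RAM.init (encodeDigraph E)) s t ∧
      (∃ v : Fin n, s.reg 0 = (v : ℕ) ∧ G.IsMostCentral v) ∧
      (t : ℝ) ≤ K * ((n : ℝ) + (E.length : ℝ)) ^ a

/-! A fast algorithm for the most closeness-central vertex decides `k`-satisfiability in time
`O((2 - δ) ^ N)`, with one `δ` for all `k`, by meet in the middle.

*The graph.* Split the `N` variables in two halves of `H = ⌈N / 2⌉` (with an unused one if `N` is
odd), and let `A = 2 ^ H`. A formula with `M` clauses is satisfiable if and only if some first half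
assignment `a` and some second half assignment `b` do not both falsify the same clause
(`forall_mul_eq_zero_iff`). The graph has a vertex for each half assignment on either side. Two
chains of four vertices belong to each clause, and `a` points to the start of one of them, according
to whether it falsifies the clause; the falsified chain ends with edges to all `b` that falsify the
clause too. So `a` reaches every vertex `b` that it conflicts with, at distance `5`. It also points
to three hubs with `4 * A` dummies each, which makes its average distance about `2`. As all edges go
from one layer to the next, all distances are differences of layers, and if `a` conflicts with `k`
of the `b`, its Lin's index is `(3 + 12 A + 4 M + k) ^ 2 / ((n - 1) (3 + 24 A + 10 M + 5 k))`
(`closeness_eq`). A vertex at more than twice the average distance lowers the index. Hence the index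
for `k < A` is larger than for `k = A`. It is larger than `4 A / (n - 1)`, too, which bounds the
index of every vertex that is not a first half assignment, since such a vertex reaches at most `4 A`
others; this is why there are several hubs. So if the formula is satisfiable, the most central
vertex is a first half assignment that extends to a satisfying assignment
(`exists_of_isMostCentral`). Isolated vertices do not change the comparison, and make the graph as
sparse as desired.

*The program.* It writes the graph, runs the given program on it with renamed registers and arrays
(`RAM.Exec.shift`), takes the low bits of the returned vertex for a first half assignment, and tries
all second halves (`exec_decideSat`). A wrong vertex can do no harm, as the answer is `1` only if a
satisfying assignment is found. Correctness and cost come from a program logic (`RAM.Runs`) that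
counts elementary steps, under the proviso that all numbers stay below a bound `W`.

*The time.* There are at most `(2 * N + 1) ^ k` clauses, so the graph has size `2 ^ (N / 2)` up to a
polynomial factor in `N`, and so has the number of steps outside of the subroutine, while numbers
have `O(N ^ c)` bits. The total is `2 ^ (N * (1 - ε / 2))` up to a polynomial, which is
`O((2 - δ) ^ N)` for `2 - δ = 2 ^ (1 - ε / 4)` (for `ε ≤ 1`). No sparsification is needed. -/

namespace RAM

/-! ### Renaming the registers and arrays of a program -/

/-- The program with `R` added to the names of all registers and `J` to those of all arrays. -/
def Prog.shift (R J : ℕ) : Prog → Prog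
  | .skip => .skip
  | .const r c => .const (R + r) c
  | .op o r a b => .op o (R + r) (R + a) (R + b)
  | .load r j a => .load (R + r) (J + j) (R + a)
  | .store j a b => .store (J + j) (R + a) (R + b)
  | .seq p q => .seq (p.shift R J) (q.shift R J)
  | .ite a p q => .ite (R + a) (p.shift R J) (q.shift R J)
  | .loop a p => .loop (R + a) (p.shift R J)

/-- The registers from `R` on and the arrays from `J` on are those of `s`; the others are those of
`u`. -/
def State.graft (R J : ℕ) (u s : State) : State where
  reg r := if r < R then u.reg r else s.reg (r - R)
  mem j := if j < J then u.mem j else s.mem (j - J)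

theorem State.graft_reg (R J : ℕ) (u s : State) (r : ℕ) :
    (State.graft R J u s).reg (R + r) = s.reg r := by
  simp [State.graft]

theorem State.graft_mem (R J : ℕ) (u s : State) (j : ℕ) :
    (State.graft R J u s).mem (J + j) = s.mem j := by
  simp [State.graft]

theorem State.graft_setReg (R J : ℕ) (u s : State) (r x : ℕ) :
    (State.graft R J u s).setReg (R + r) x = State.graft R J u (s.setReg r x) := by
  ext i
  · by_cases h : i < R
    · have : i ≠ R + r := by omega
      simp [State.graft, State.setReg, h, this]
    · obtain ⟨d, rfl⟩ := Nat.exists_eq_add_of_le (not_lt.mp h)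
      by_cases hd : d = r
      · simp [State.graft, State.setReg, hd]
      · simp [State.graft, State.setReg, hd]
  · rfl

theorem State.graft_setMem (R J : ℕ) (u s : State) (j i x : ℕ) :
    (State.graft R J u s).setMem (J + j) i x = State.graft R J u (s.setMem j i x) := by
  ext l k
  · rfl
  · by_cases h : l < J
    · have : l ≠ J + j := by omega
      simp [State.graft, State.setMem, h, this]
    · obtain ⟨d, rfl⟩ := Nat.exists_eq_add_of_le (not_lt.mp h)
      by_cases hd : d = j
      · subst hd; simp [State.graft, State.setMem]
      · simp [State.graft, State.setMem, hd]

/-- A program runs on the grafted registers and arrays as it does on its own, at the same cost. -/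
theorem Exec.shift {p : Prog} {s s' : State} {t : ℕ} (h : Exec p s s' t) (R J : ℕ) (u : State) :
    Exec (p.shift R J) (State.graft R J u s) (State.graft R J u s') t := by
  induction h with
  | skip s => exact .skip _
  | const s r c =>
    rw [← State.graft_setReg]
    exact .const _ _ _
  | op s o r a b =>
    have := Exec.op (State.graft R J u s) o (R + r) (R + a) (R + b)
    rwa [State.graft_reg, State.graft_reg, State.graft_setReg] at this
  | load s r j a =>
    have := Exec.load (State.graft R J u s) (R + r) (J + j) (R + a)
    rwa [State.graft_reg, State.graft_mem, State.graft_setReg] at this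
  | store s j a b =>
    have := Exec.store (State.graft R J u s) (J + j) (R + a) (R + b)
    rwa [State.graft_reg, State.graft_reg, State.graft_setMem] at this
  | seq _ _ h₁ h₂ => exact .seq h₁ h₂
  | @iteTrue a p q s s' t ha _ ih =>
    rw [← State.graft_reg R J u s a] at ha ⊢
    exact .iteTrue ha ih
  | @iteFalse a p q s s' t ha _ ih =>
    rw [← State.graft_reg R J u s a] at ha
    exact .iteFalse ha ih
  | @loopDone a p s ha =>
    rw [← State.graft_reg R J u s a] at ha
    exact .loopDone ha
  | @loopStep a p s s' s'' t t' ha _ _ h₁ h₂ =>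
    rw [← State.graft_reg R J u s a] at ha ⊢
    exact .loopStep ha h₁ h₂

/-! ### Frames -/

/-- The registers that a program may write. -/
def Prog.regs : Prog → List ℕ
  | .skip => []
  | .const r _ => [r]
  | .op _ r _ _ => [r]
  | .load r _ _ => [r]
  | .store _ _ _ => []
  | .seq p q => p.regs ++ q.regs
  | .ite _ p q => p.regs ++ q.regs
  | .loop _ p => p.regs

/-- The arrays that a program may write. -/
def Prog.arrs : Prog → List ℕ
  | .skip => []
  | .const _ _ => []
  | .op _ _ _ _ => []
  | .load _ _ _ => []
  | .store j _ _ => [j]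
  | .seq p q => p.arrs ++ q.arrs
  | .ite _ p q => p.arrs ++ q.arrs
  | .loop _ p => p.arrs

/-- The two states differ only in registers and arrays that `p` may write. -/
structure Frame (p : Prog) (s s' : State) : Prop where
  reg : ∀ r, r ∉ p.regs → s'.reg r = s.reg r
  mem : ∀ j, j ∉ p.arrs → s'.mem j = s.mem j

theorem Frame.refl (p : Prog) (s : State) : Frame p s s := ⟨fun _ _ => rfl, fun _ _ => rfl⟩

theorem Frame.trans {p : Prog} {s s' s'' : State} (h : Frame p s s') (h' : Frame p s' s'') :
    Frame p s s'' :=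
  ⟨fun r hr => (h'.reg r hr).trans (h.reg r hr), fun j hj => (h'.mem j hj).trans (h.mem j hj)⟩

theorem Frame.mono {p q : Prog} {s s' : State} (h : Frame p s s') (hr : p.regs ⊆ q.regs)
    (hj : p.arrs ⊆ q.arrs) : Frame q s s' :=
  ⟨fun r h' => h.reg r fun h'' => h' (hr h''), fun j h' => h.mem j fun h'' => h' (hj h'')⟩

@[simp] theorem State.reg_setReg (s : State) (r x r' : ℕ) :
    (s.setReg r x).reg r' = if r' = r then x else s.reg r' := by
  simp [State.setReg, Function.update_apply]

@[simp] theorem State.mem_setReg (s : State) (r x : ℕ) : (s.setReg r x).mem = s.mem := rfl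

@[simp] theorem State.reg_setMem (s : State) (j i x : ℕ) : (s.setMem j i x).reg = s.reg := rfl

@[simp] theorem State.mem_setMem (s : State) (j i x j' : ℕ) :
    (s.setMem j i x).mem j' = if j' = j then Function.update (s.mem j) i x else s.mem j' := by
  by_cases h : j' = j
  · subst h; simp [State.setMem]
  · simp [State.setMem, h]

theorem Exec.frame {p : Prog} {s s' : State} {t : ℕ} (h : Exec p s s' t) : Frame p s s' := by
  induction h with
  | skip s => exact .refl _ _
  | const s r c => exact ⟨fun i hi => by simp_all [Prog.regs], fun _ _ => rfl⟩
  | op s o r a b => exact ⟨fun i hi => by simp_all [Prog.regs], fun _ _ => rfl⟩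
  | load s r j a => exact ⟨fun i hi => by simp_all [Prog.regs], fun _ _ => rfl⟩
  | store s j a b => exact ⟨fun _ _ => rfl, fun i hi => by simp_all [Prog.arrs]⟩
  | seq _ _ h₁ h₂ =>
    exact (h₁.mono (by simp [Prog.regs]) (by simp [Prog.arrs])).trans
      (h₂.mono (by simp [Prog.regs]) (by simp [Prog.arrs]))
  | iteTrue _ _ ih => exact ih.mono (by simp [Prog.regs]) (by simp [Prog.arrs])
  | iteFalse _ _ ih => exact ih.mono (by simp [Prog.regs]) (by simp [Prog.arrs])
  | loopDone => exact .refl _ _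
  | loopStep _ _ _ h₁ h₂ =>
    exact (h₁.mono (by simp [Prog.regs]) (by simp [Prog.arrs])).trans h₂

/-! ### A program logic that counts steps -/

/-- The number of registers for the code written here; the ones from this number on belong to the
program that is called as a subroutine. -/
abbrev ownRegs : ℕ := 40

/-- The number of arrays for the code written here. The next one holds the word that is handed to
the subroutine. -/
abbrev ownArrs : ℕ := 3

/-- All own registers and arrays hold numbers up to `W`. -/
structure Bounded (W : ℕ) (s : State) : Prop where
  reg : ∀ r < ownRegs, s.reg r ≤ W
  mem : ∀ j < ownArrs, ∀ i, s.mem j i ≤ W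

/-- Total correctness with a bound on the cost. If the own numbers are at most `W` at the start,
then they are so at the end, `Q` holds at the end, and `p` takes at most `T` elementary steps, each
on two such numbers. -/
def Runs (W : ℕ) (p : Prog) (s : State) (T : ℕ) (Q : State → Prop) : Prop :=
  Bounded W s →
    ∃ s' t, Exec p s s' t ∧ Bounded W s' ∧ t ≤ T * (1 + 2 * Nat.size W) ∧ Q s'

theorem Bounded.setReg {W : ℕ} {s : State} (h : Bounded W s) (r : ℕ) {x : ℕ} (hx : x ≤ W) :
    Bounded W (s.setReg r x) where
  reg i hi := by
    rw [State.reg_setReg]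
    split_ifs
    · exact hx
    · exact h.reg i hi
  mem := h.mem

theorem Bounded.setMem {W : ℕ} {s : State} (h : Bounded W s) (j i : ℕ) {x : ℕ} (hx : x ≤ W) :
    Bounded W (s.setMem j i x) where
  reg := h.reg
  mem l hl k := by
    rw [State.mem_setMem]
    split_ifs with hlj
    · subst hlj
      rw [Function.update_apply]
      split_ifs
      · exact hx
      · exact h.mem l hl k
    · exact h.mem l hl k

theorem Runs.mono {W : ℕ} {p : Prog} {s : State} {T T' : ℕ} {Q Q' : State → Prop}
    (h : Runs W p s T Q) (hT : T ≤ T') (hQ : ∀ s', Q s' → Q' s') : Runs W p s T' Q' := by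
  intro hs
  obtain ⟨s', t, he, hb, ht, hq⟩ := h hs
  exact ⟨s', t, he, hb, ht.trans (Nat.mul_le_mul_right _ hT), hQ _ hq⟩

theorem Runs.frame {W : ℕ} {p : Prog} {s : State} {T : ℕ} {Q : State → Prop}
    (h : Runs W p s T Q) : Runs W p s T fun s' => Q s' ∧ Frame p s s' := by
  intro hs
  obtain ⟨s', t, he, hb, ht, hq⟩ := h hs
  exact ⟨s', t, he, hb, ht, hq, he.frame⟩

theorem Runs.seq {W : ℕ} {p q : Prog} {s : State} {T T' : ℕ} {Q : State → Prop}
    (h : Runs W p s T fun s' => Runs W q s' T' Q) : Runs W (.seq p q) s (T + T') Q := by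
  intro hs
  obtain ⟨s', t, he, hb, ht, hq⟩ := h hs
  obtain ⟨s'', t', he', hb', ht', hq'⟩ := hq hb
  exact ⟨s'', t + t', .seq he he', hb', by rw [Nat.add_mul]; omega, hq'⟩

/-- Sequencing with the frame of the first program at hand, and any sufficient step count. -/
theorem Runs.seq_frame {W : ℕ} {p q : Prog} {s : State} {T T' S : ℕ} {P Q : State → Prop}
    (h : Runs W p s T P) (hS : T + T' ≤ S)
    (h' : ∀ s', P s' → Frame p s s' → Runs W q s' T' Q) : Runs W (.seq p q) s S Q :=
  (Runs.seq (h.frame.mono le_rfl fun s' hs' => h' s' hs'.1 hs'.2)).mono hS fun _ => id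

theorem Runs.skip {W : ℕ} {s : State} {T : ℕ} {Q : State → Prop} (hQ : Q s) :
    Runs W .skip s (T + 1) Q :=
  fun hs => ⟨_, _, .skip s, hs, by nlinarith [Nat.zero_le (T * (1 + 2 * Nat.size W))], hQ⟩

theorem Runs.const {W r c : ℕ} {s : State} {T : ℕ} {Q : State → Prop} (hc : c ≤ W)
    (hQ : Q (s.setReg r c)) : Runs W (.const r c) s (T + 1) Q := by
  intro hs
  refine ⟨_, _, .const s r c, hs.setReg r hc, ?_, hQ⟩
  have := Nat.size_le_size hc
  nlinarith [Nat.zero_le (T * (1 + 2 * Nat.size W))]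

theorem Runs.op {W : ℕ} {o : Op} {r a b : ℕ} {s : State} {T : ℕ} {Q : State → Prop}
    (ha : a < ownRegs) (hb : b < ownRegs)
    (hv : s.reg a ≤ W → s.reg b ≤ W → o.eval (s.reg a) (s.reg b) ≤ W)
    (hQ : Q (s.setReg r (o.eval (s.reg a) (s.reg b)))) : Runs W (.op o r a b) s (T + 1) Q := by
  intro hs
  refine ⟨_, _, .op s o r a b, hs.setReg r (hv (hs.reg a ha) (hs.reg b hb)), ?_, hQ⟩
  have h₁ := Nat.size_le_size (hs.reg a ha)
  have h₂ := Nat.size_le_size (hs.reg b hb)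
  nlinarith [Nat.zero_le (T * (1 + 2 * Nat.size W))]

theorem Runs.add {W r a b : ℕ} {s : State} {T : ℕ} {Q : State → Prop}
    (ha : a < ownRegs) (hb : b < ownRegs) (hv : s.reg a + s.reg b ≤ W)
    (hQ : Q (s.setReg r (s.reg a + s.reg b))) : Runs W (.op .add r a b) s (T + 1) Q :=
  .op ha hb (fun _ _ => hv) hQ

theorem Runs.mul {W r a b : ℕ} {s : State} {T : ℕ} {Q : State → Prop}
    (ha : a < ownRegs) (hb : b < ownRegs) (hv : s.reg a * s.reg b ≤ W)
    (hQ : Q (s.setReg r (s.reg a * s.reg b))) : Runs W (.op .mul r a b) s (T + 1) Q :=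
  .op ha hb (fun _ _ => hv) hQ

theorem Runs.sub {W r a b : ℕ} {s : State} {T : ℕ} {Q : State → Prop}
    (ha : a < ownRegs) (hb : b < ownRegs)
    (hQ : Q (s.setReg r (s.reg a - s.reg b))) : Runs W (.op .sub r a b) s (T + 1) Q :=
  .op ha hb (fun h _ => (Nat.sub_le _ _).trans h) hQ

theorem Runs.div {W r a b : ℕ} {s : State} {T : ℕ} {Q : State → Prop}
    (ha : a < ownRegs) (hb : b < ownRegs)
    (hQ : Q (s.setReg r (s.reg a / s.reg b))) : Runs W (.op .div r a b) s (T + 1) Q :=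
  .op ha hb (fun h _ => (Nat.div_le_self _ _).trans h) hQ

theorem Runs.load {W r j a : ℕ} {s : State} {T : ℕ} {Q : State → Prop}
    (ha : a < ownRegs) (hj : j < ownArrs)
    (hQ : Q (s.setReg r (s.mem j (s.reg a)))) : Runs W (.load r j a) s (T + 1) Q := by
  intro hs
  refine ⟨_, _, .load s r j a, hs.setReg r (hs.mem j hj _), ?_, hQ⟩
  have h₁ := Nat.size_le_size (hs.reg a ha)
  have h₂ := Nat.size_le_size (hs.mem j hj (s.reg a))
  nlinarith [Nat.zero_le (T * (1 + 2 * Nat.size W))]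

theorem Runs.store {W j a b : ℕ} {s : State} {T : ℕ} {Q : State → Prop}
    (ha : a < ownRegs) (hb : b < ownRegs)
    (hQ : Q (s.setMem j (s.reg a) (s.reg b))) : Runs W (.store j a b) s (T + 1) Q := by
  intro hs
  refine ⟨_, _, .store s j a b, hs.setMem j _ (hs.reg b hb), ?_, hQ⟩
  have h₁ := Nat.size_le_size (hs.reg a ha)
  have h₂ := Nat.size_le_size (hs.reg b hb)
  nlinarith [Nat.zero_le (T * (1 + 2 * Nat.size W))]

theorem Runs.ite {W a : ℕ} {p q : Prog} {s : State} {T : ℕ} {Q : State → Prop} (ha : a < ownRegs)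
    (hp : s.reg a ≠ 0 → Runs W p s T Q) (hq : s.reg a = 0 → Runs W q s T Q) :
    Runs W (.ite a p q) s (T + 1) Q := by
  intro hs
  have h₁ := Nat.size_le_size (hs.reg a ha)
  by_cases h : s.reg a = 0
  · obtain ⟨s', t, he, hb, ht, hQ⟩ := hq h hs
    exact ⟨s', _, .iteFalse h he, hb, by nlinarith, hQ⟩
  · obtain ⟨s', t, he, hb, ht, hQ⟩ := hp h hs
    exact ⟨s', _, .iteTrue h he, hb, by nlinarith, hQ⟩

/-- A loop that runs `m` times, with an invariant `I`. -/
theorem Runs.loop {W k : ℕ} {p : Prog} {s₀ : State} {T : ℕ} {Q : State → Prop} (m : ℕ)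
    (I : ℕ → State → Prop) (hk : k < ownRegs) (h₀ : I 0 s₀)
    (hc : ∀ j ≤ m, ∀ s, I j s → s.reg k = m - j)
    (step : ∀ j < m, ∀ s, I j s → Frame p s₀ s → Runs W p s T (I (j + 1)))
    (fin : ∀ s, I m s → Frame p s₀ s → Q s) : Runs W (.loop k p) s₀ (m * (T + 1) + 1) Q := by
  suffices H : ∀ d ≤ m, ∀ s, I (m - d) s → Frame p s₀ s →
      Runs W (.loop k p) s (d * (T + 1) + 1) Q from
    H m le_rfl s₀ (by simpa using h₀) (.refl _ _)
  intro d
  induction d with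
  | zero =>
    intro _ s hI hf hs
    refine ⟨s, 1, .loopDone ?_, hs, by omega, fin s (by simpa using hI) hf⟩
    simpa using hc m le_rfl s (by simpa using hI)
  | succ d ih =>
    intro hd s hI hf hs
    have hk' := hc _ (Nat.sub_le _ _) s hI
    obtain ⟨s', t, he, hb, ht, hI'⟩ := step _ (by omega) s hI hf hs
    rw [show m - (d + 1) + 1 = m - d by omega] at hI'
    obtain ⟨s'', t', he', hb', ht', hQ⟩ := ih (by omega) s' hI' (hf.trans he.frame) hb
    refine ⟨s'', _, .loopStep (by omega) he he', hb', ?_, hQ⟩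
    have := Nat.size_le_size (hs.reg k hk)
    have h3 : ((d + 1) * (T + 1) + 1) * (1 + 2 * Nat.size W) =
      (1 + 2 * Nat.size W) + T * (1 + 2 * Nat.size W)
        + (d * (T + 1) + 1) * (1 + 2 * Nat.size W) := by ring
    omega

/-- Run one program after another. -/
infixr:60 " ;; " => Prog.seq

theorem Runs.step {W : ℕ} {p q : Prog} {s : State} {T : ℕ} {Q : State → Prop}
    (h : Runs W p s 1 fun s' => Runs W q s' T Q) : Runs W (p ;; q) s (T + 1) Q :=
  Nat.add_comm T 1 ▸ Runs.seq h

/-! ### Names of registers -/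

/-- the answer -/
@[simp] abbrev rAns : ℕ := 0
/-- the number `1` -/
@[simp] abbrev rOne : ℕ := 1
/-- the number of clauses -/
@[simp] abbrev rM : ℕ := 2
/-- half of the number of variables, rounded up -/
@[simp] abbrev rH : ℕ := 3
/-- the number of half assignments -/
@[simp] abbrev rA : ℕ := 4
/-- the first chain vertex -/
@[simp] abbrev rX : ℕ := 5
/-- the number `2` -/
@[simp] abbrev rTwo : ℕ := 6
/-- where the formula is read -/
@[simp] abbrev rPtr : ℕ := 7
/-- where the graph is written -/
@[simp] abbrev rOut : ℕ := 8
/-- whether the last clause that was read is falsified -/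
@[simp] abbrev rFals : ℕ := 9
/-- the length of a clause -/
@[simp] abbrev rLen : ℕ := 10
/-- a literal -/
@[simp] abbrev rLit : ℕ := 11
/-- a scratch register -/
@[simp] abbrev rTmp : ℕ := 12
/-- the part of a half assignment that is still to be expanded -/
@[simp] abbrev rY : ℕ := 13
/-- half of `rY` -/
@[simp] abbrev rQ : ℕ := 14
/-- a truth value -/
@[simp] abbrev rBit : ℕ := 15
/-- the address of a literal -/
@[simp] abbrev rAddr : ℕ := 16
/-- counter of innermost loops -/
@[simp] abbrev rI : ℕ := 18
/-- remaining rounds of innermost loops -/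
@[simp] abbrev rK : ℕ := 19
/-- counter of outer loops -/
@[simp] abbrev rV : ℕ := 20
/-- remaining rounds of outer loops -/
@[simp] abbrev rKV : ℕ := 21
/-- the index of a clause -/
@[simp] abbrev rC : ℕ := 22
/-- remaining clauses -/
@[simp] abbrev rKC : ℕ := 23
/-- the number `0` -/
@[simp] abbrev rZero : ℕ := 24
/-- a scratch register -/
@[simp] abbrev rT : ℕ := 25
/-- a scratch register -/
@[simp] abbrev rU : ℕ := 26
/-- the first hub -/
@[simp] abbrev rHub : ℕ := 27
/-- the number of rounds of a loop -/
@[simp] abbrev rL : ℕ := 28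
/-- whether no clause is falsified so far -/
@[simp] abbrev rOk : ℕ := 29
/-- the start of the current clause -/
@[simp] abbrev rStart : ℕ := 30
/-- the vertex that the subroutine returns -/
@[simp] abbrev rSrc : ℕ := 31
/-- the number of variables -/
@[simp] abbrev rN : ℕ := 32

/-! ### Bounded iteration -/

/-- Copy a register, as a quotient; `rOne` has to hold `1`. -/
def copy (r a : ℕ) : Prog := .op .div r a rOne

/-- Run `p` with `i = 0, …, n - 1`, where `n` stands in register `n`; `k` counts down. -/
def forLoop (i k n : ℕ) (p : Prog) : Prog :=
  .const i 0 ;; copy k n ;; .loop k (p ;; .op .add i i rOne ;; .op .sub k k rOne)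

theorem Runs.copy {W r a : ℕ} {s : State} {T : ℕ} {Q : State → Prop} (ha : a < ownRegs)
    (h1 : s.reg rOne = 1) (hQ : Q (s.setReg r (s.reg a))) : Runs W (copy r a) s (T + 1) Q :=
  .div ha (by decide) (by rwa [h1, Nat.div_one])

/-- The rule for bounded iteration. The invariant may not depend on the two counters, which the
loop maintains itself. -/
theorem Runs.forLoop {W i k n : ℕ} {p : Prog} {s₀ : State} {T S : ℕ} {Q : State → Prop} (m : ℕ)
    (hm : s₀.reg n = m) (h1 : s₀.reg rOne = 1)
    (I : ℕ → State → Prop)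
    (h₀ : I 0 s₀)
    (step : ∀ j < m, ∀ s, I j s → s.reg i = j → Frame (forLoop i k n p) s₀ s →
      Runs W p s T (I (j + 1)))
    (fin : ∀ s, I m s → Frame (forLoop i k n p) s₀ s → Q s)
    (hI : ∀ j s x y, I j s → I j ((s.setReg i x).setReg k y))
    (hS : m * (T + 3) + 3 ≤ S)
    (hlt : n < ownRegs ∧ i < ownRegs ∧ k < ownRegs := by decide)
    (hne : i ≠ k ∧ i ≠ rOne ∧ k ≠ rOne ∧ n ≠ i := by decide)
    (hp : i ∉ p.regs ∧ k ∉ p.regs ∧ rOne ∉ p.regs := by decide) :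
    Runs W (forLoop i k n p) s₀ S Q := by
  obtain ⟨hn, hi, hk⟩ := hlt
  obtain ⟨hik, hi1, hk1, hni⟩ := hne
  obtain ⟨hpi, hpk, hp1⟩ := hp
  intro hs
  have hmW : m ≤ W := hm ▸ hs.reg n hn
  refine Runs.mono (T := m * (T + 1 + 1 + 1) + 1 + 1 + 1) ?_ hS (fun _ => id) hs
  have h1' : 1 ≤ W := h1 ▸ hs.reg rOne (by decide)
  refine .step (.const (Nat.zero_le _) (.step (.copy hn (by simpa [Ne.symm hi1] using h1) ?_)))
  have hf₀ : Frame (RAM.forLoop i k n p) s₀ ((s₀.setReg i 0).setReg k ((s₀.setReg i 0).reg n)) := by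
    refine ⟨fun r hr => ?_, fun _ _ => rfl⟩
    have hr' : r ≠ i ∧ r ≠ k := by
      constructor <;> rintro rfl <;> exact hr (by simp [RAM.forLoop, RAM.copy, Prog.regs])
    simp [hr']
  have hfl : ∀ {s}, Frame (p ;; .op .add i i rOne ;; .op .sub k k rOne)
      ((s₀.setReg i 0).setReg k ((s₀.setReg i 0).reg n)) s → Frame (RAM.forLoop i k n p) s₀ s :=
    fun h => hf₀.trans (h.mono (by intro r; simp [RAM.forLoop, RAM.copy, Prog.regs]; tauto)
      (by simp [RAM.forLoop, RAM.copy, Prog.arrs]))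
  refine Runs.loop m (fun j s => I j s ∧ s.reg i = j ∧ s.reg k = m - j ∧ s.reg rOne = 1) hk
    ⟨hI _ _ _ _ h₀, by simp [hik], by simp [hni, hm], ?_⟩ (fun j _ s h => h.2.2.1) ?_
    (fun s hI hf => fin s hI.1 (hfl hf))
  · simpa [Ne.symm hi1, Ne.symm hk1] using h1
  · rintro j hj s ⟨hIj, hij, hkj, h1j⟩ hf
    refine Runs.seq_frame (T' := 2) (step j hj s hIj hij (hfl hf)) le_rfl ?_
    intro s' hI' hf'
    have hi' := hf'.reg i hpi
    have hk' := hf'.reg k hpk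
    have h1'' := hf'.reg rOne hp1
    refine .step (.add hi (by decide) (by omega) (.sub hk (by decide) ?_))
    refine ⟨hI _ _ _ _ hI', ?_, ?_, ?_⟩
    · simp only [State.reg_setReg, if_neg hik, if_true]; omega
    · simp only [State.reg_setReg, if_neg (Ne.symm hik), if_neg (Ne.symm hi1), if_true]; omega
    · simp only [State.reg_setReg, if_neg (Ne.symm hk1), if_neg (Ne.symm hi1)]; omega

/-! ### Half assignments and clauses -/

/-- The literals that a half assignment makes true. The bits of `a` are the values of the variables
`off, …, off + H - 1`; the literal `2 * i + b` says that variable `i` has the value `b`. -/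
def litTable (off H a l : ℕ) : ℕ :=
  if off ≤ l / 2 ∧ l / 2 < off + H ∧ a / 2 ^ (l / 2 - off) % 2 = l % 2 then 1 else 0

/-- Write the table of the half assignment in register `src` to array `j`; register `off` holds the
first variable. Only the lowest `H` bits are read. -/
def expand (j src off : ℕ) : Prog :=
  copy rY src ;;
  forLoop rI rK rH (
    .op .div rQ rY rTwo ;;
    .op .mul rBit rQ rTwo ;;
    .op .sub rBit rY rBit ;;
    .op .add rAddr off rI ;;
    .op .mul rAddr rAddr rTwo ;;
    .op .sub rTmp rOne rBit ;;
    .store j rAddr rTmp ;;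
    .op .add rAddr rAddr rOne ;;
    .store j rAddr rBit ;;
    copy rY rQ)

theorem litTable_of_not_mem {off H a l : ℕ} (h : ¬ (off ≤ l / 2 ∧ l / 2 < off + H)) :
    litTable off H a l = 0 := by
  rw [litTable, if_neg (by tauto)]

theorem runs_expand {W j src off : ℕ} {s : State} {H o : ℕ}
    (hsrc : src = rV ∨ src = rSrc) (hoff : off = rZero ∨ off = rH)
    (h1 : s.reg rOne = 1) (h2 : s.reg rTwo = 2) (hH : s.reg rH = H) (ho : s.reg off = o)
    (hW : 2 * (o + H) ≤ W) (haW : s.reg src ≤ W)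
    (hmem : ∀ l, ¬ (o ≤ l / 2 ∧ l / 2 < o + H) → s.mem j l = 0) :
    Runs W (expand j src off) s (H * 13 + 4)
      fun s' => s'.mem j = litTable o H (s.reg src) := by
  set a := s.reg src with ha
  have hsrc' : src < ownRegs := by rcases hsrc with rfl | rfl <;> decide
  have hoff' : off < ownRegs := by rcases hoff with rfl | rfl <;> decide
  refine .step (.copy hsrc' h1 ?_)
  refine Runs.forLoop (T := 10) H (by simpa using hH) (by simpa using h1)
    (fun t s' => s'.reg rY = a / 2 ^ t ∧
      ∀ l, (o + t ≤ l / 2 ∧ l / 2 < o + H) ∨ s'.mem j l = litTable o H a l)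
    ?_ ?_ ?_ ?_ le_rfl (by decide) (by decide) (by simp [Prog.regs, copy])
  · refine ⟨by simp [ha], fun l => ?_⟩
    by_cases h : o ≤ l / 2 ∧ l / 2 < o + H
    · exact .inl h
    · refine .inr ((hmem l h).trans (litTable_of_not_mem h).symm)
  · rintro t ht s' ⟨hY, hl⟩ hi hf
    have e1 : s'.reg rOne = 1 := (hf.reg _ (by simp [Prog.regs, forLoop, copy])).trans
      (by simpa using h1)
    have e2 : s'.reg rTwo = 2 := (hf.reg _ (by simp [Prog.regs, forLoop, copy])).trans
      (by simpa using h2)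
    have eo : s'.reg off = o := by
      rw [← ho]
      rcases hoff with rfl | rfl
      · exact (hf.reg _ (by simp [Prog.regs, forLoop, copy])).trans (by simp)
      · exact (hf.reg _ (by simp [Prog.regs, forLoop, copy])).trans (by simp)
    have hoffne : off ≠ rQ ∧ off ≠ rBit := by rcases hoff with rfl | rfl <;> decide
    simp only [rQ, rBit] at hoffne
    simp only [rOne, rTwo, rY, rI] at e1 e2 hY hi
    refine .step (.div (by decide) (by decide) ?_)
    refine .step (.mul (by decide) (by decide) ?_ ?_)
    · simp only [State.reg_setReg, rQ, rTwo, rY, e2, hY]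
      simp
      exact (Nat.div_mul_le_self _ _).trans ((Nat.div_le_self _ _).trans haW)
    refine .step (.sub (by decide) (by decide) ?_)
    refine .step (.add hoff' (by decide) ?_ ?_)
    · simp [hoffne, eo, hi]; omega
    refine .step (.mul (by decide) (by decide) ?_ ?_)
    · simp [hoffne, eo, hi, e2]; omega
    refine .step (.sub (by decide) (by decide) ?_)
    refine .step (.store (by decide) (by decide) ?_)
    refine .step (.add (by decide) (by decide) ?_ ?_)
    · simp [hoffne, eo, hi, e2, e1]; omega
    refine .step (.store (by decide) (by decide) ?_)
    refine .copy (by decide) (by simp [e1]) ?_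
    simp [hoffne, eo, hi, e2, e1, hY]
    refine ⟨by rw [Nat.div_div_eq_div_mul, pow_succ], fun l => ?_⟩
    have hbit : a / 2 ^ t - a / 2 ^ t / 2 * 2 = a / 2 ^ t % 2 := by omega
    rw [hbit, Function.update_apply, Function.update_apply]
    by_cases hl1 : l = (o + t) * 2 + 1
    · right
      have hdiv : l / 2 = o + t := by omega
      have hmod : l % 2 = 1 := by omega
      rw [if_pos hl1, litTable, hdiv, hmod, Nat.add_sub_cancel_left]
      split_ifs <;> omega
    by_cases hl2 : l = (o + t) * 2
    · right
      have hdiv : l / 2 = o + t := by omega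
      have hmod : l % 2 = 0 := by omega
      rw [if_neg hl1, if_pos hl2, litTable, hdiv, hmod, Nat.add_sub_cancel_left]
      split_ifs <;> omega
    rw [if_neg hl1, if_neg hl2]
    exact (hl l).imp (by omega) id
  · rintro s' ⟨_, hl⟩ _
    funext l
    exact (hl l).resolve_left (by omega)
  · simp
/-- `1` if the clause has no literal that is true in the table, otherwise `0`. -/
def falsified (tab : ℕ → ℕ) (C : List ℕ) : ℕ := if ∀ l ∈ C, tab l = 0 then 1 else 0

theorem falsified_append_singleton (tab : ℕ → ℕ) (C : List ℕ) (l : ℕ) :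
    falsified tab (C ++ [l]) = if tab l = 0 then falsified tab C else 0 := by
  simp only [falsified, List.mem_append, List.mem_singleton]
  split_ifs with h₁ h₂ h₃ h₃ <;> grind

/-- A clause as a word. -/
def clauseWord (C : List ℕ) : List ℕ := C.length :: C

/-- The formula with the clauses `cs`, in `N` variables, as a word. -/
def formulaWord (N : ℕ) (cs : List (List ℕ)) : List ℕ :=
  N :: cs.length :: cs.flatMap clauseWord

/-- The address at which clause number `c` starts. -/
def clauseStart (cs : List (List ℕ)) (c : ℕ) : ℕ := 2 + ((cs.take c).flatMap clauseWord).length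

theorem clauseStart_succ {cs : List (List ℕ)} {c : ℕ} (hc : c < cs.length) :
    clauseStart cs (c + 1) = clauseStart cs c + 1 + cs[c].length := by
  rw [clauseStart, List.take_add_one, List.getElem?_eq_getElem hc, List.flatMap_append,
    List.length_append, clauseStart]
  simp only [Option.toList_some, List.flatMap_singleton, clauseWord, List.length_cons]
  omega

theorem formulaWord_getD {N : ℕ} {cs : List (List ℕ)} {c i : ℕ} (hc : c < cs.length)
    (hi : i < (clauseWord cs[c]).length) :
    (formulaWord N cs).getD (clauseStart cs c + i) 0 = (clauseWord cs[c])[i] := by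
  have h : cs.flatMap clauseWord =
      (cs.take c).flatMap clauseWord ++
        (clauseWord cs[c] ++ (cs.drop (c + 1)).flatMap clauseWord) := by
    rw [← List.flatMap_cons, ← List.drop_eq_getElem_cons hc, ← List.flatMap_append,
      List.take_append_drop]
  rw [formulaWord, clauseStart, show 2 + ((cs.take c).flatMap clauseWord).length + i =
    (((cs.take c).flatMap clauseWord).length + i) + 1 + 1 by omega, List.getD_cons_succ,
    List.getD_cons_succ, h, List.getD_append_right _ _ _ _ (by omega), Nat.add_sub_cancel_left,
    List.getD_append _ _ _ _ hi, List.getD_eq_getElem]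

theorem clauseStart_le (N : ℕ) {cs : List (List ℕ)} (c : ℕ) :
    clauseStart cs (c + 1) ≤ (formulaWord N cs).length := by
  have h : cs.flatMap clauseWord =
      (cs.take (c + 1)).flatMap clauseWord ++ (cs.drop (c + 1)).flatMap clauseWord := by
    rw [← List.flatMap_append, List.take_append_drop]
  rw [formulaWord, clauseStart, h, List.length_cons, List.length_cons, List.length_append]
  omega

/-- Read a clause, and find out whether it has no true literal in the table in array `j`. -/
def checkClause (j : ℕ) : Prog :=
  .load rLen 0 rPtr ;;
  .op .add rPtr rPtr rOne ;;
  .const rFals 1 ;;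
  forLoop rI rK rLen (
    .load rLit 0 rPtr ;;
    .op .add rPtr rPtr rOne ;;
    .load rTmp j rLit ;;
    .ite rTmp (.const rFals 0) .skip)

theorem runs_checkClause {W j N k c : ℕ} {cs : List (List ℕ)} {s : State} (hj : j = 1 ∨ j = 2)
    (h1 : s.reg rOne = 1) (h0 : ∀ i, s.mem 0 i = (formulaWord N cs).getD i 0)
    (hc : c < cs.length) (hk : cs[c].length ≤ k) (hptr : s.reg rPtr = clauseStart cs c)
    (hW : (formulaWord N cs).length ≤ W) :
    Runs W (checkClause j) s (k * 8 + 6)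
      fun s' => s'.reg rPtr = clauseStart cs (c + 1) ∧
        s'.reg rFals = falsified (s.mem j) cs[c] := by
  have hend := clauseStart_le N (cs := cs) c
  have hsucc := clauseStart_succ hc
  have hjlt : j < ownArrs := by rcases hj with rfl | rfl <;> decide
  have hlen : s.mem 0 (clauseStart cs c) = cs[c].length := by
    rw [h0]; exact formulaWord_getD (i := 0) hc (by simp [clauseWord])
  have hW1 : 1 ≤ W := by rw [formulaWord] at hW; simp at hW; omega
  simp only [rOne, rPtr] at h1 hptr
  refine .step (.load (by decide) (by decide) ?_)
  refine .step (.add (by decide) (by decide) ?_ ?_)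
  · simp [h1, hptr]; omega
  refine .step (.const hW1 ?_)
  refine Runs.forLoop (T := 5) cs[c].length (by simp [hptr, hlen]) (by simp [h1])
    (fun t s' => s'.reg rPtr = clauseStart cs c + 1 + t ∧
      s'.reg rFals = falsified (s.mem j) (cs[c].take t)) ?_ ?_ ?_ ?_ (by omega)
      (by decide) (by decide) (by simp [Prog.regs])
  · simp [hptr, h1, falsified]
  · rintro t ht s' ⟨hp, hu⟩ hi hf
    have e1 : s'.reg 1 = 1 := (hf.reg _ (by simp [Prog.regs, forLoop, copy])).trans
      (by simpa using h1)
    have e0 : ∀ i, s'.mem 0 i = (formulaWord N cs).getD i 0 := fun i => by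
      rw [hf.mem _ (by simp [Prog.arrs, forLoop, copy])]; exact h0 i
    have ej : s'.mem j = s.mem j := hf.mem _ (by simp [Prog.arrs, forLoop, copy])
    simp only [rPtr, rFals] at hp hu
    have hlit : s'.mem 0 (clauseStart cs c + 1 + t) = cs[c][t] := by
      rw [e0, add_assoc, formulaWord_getD hc (by simp [clauseWord]; omega)]
      simp [clauseWord, add_comm 1 t]
    refine .step (.load (by decide) (by decide) ?_)
    refine .step (.add (by decide) (by decide) ?_ ?_)
    · simp [e1, hp]; omega
    refine .step (.load (by decide) hjlt ?_)
    have htake : cs[c].take (t + 1) = cs[c].take t ++ [cs[c][t]] := by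
      rw [List.take_add_one, List.getElem?_eq_getElem ht]; rfl
    refine .ite (by decide) (fun h => .const (Nat.zero_le _) ?_) (fun h => .skip ?_)
    · simp [hp, ej, hlit] at h
      simp only [htake, falsified_append_singleton, if_neg h]
      simp [hp, e1, add_assoc]
    · simp [hp, ej, hlit] at h
      simp only [htake, falsified_append_singleton, if_pos h]
      simp [hp, e1, add_assoc, hu]
  · rintro s' ⟨hp, hu⟩ hf
    exact ⟨hp.trans hsucc.symm, by simpa using hu⟩
  · simp

/-! ### Writing a list of pairs -/

/-- The pairs as a word. -/
def pairWord (es : List (ℕ × ℕ)) : List ℕ := es.flatMap fun e => [e.1, e.2]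

theorem length_pairWord (es : List (ℕ × ℕ)) : (pairWord es).length = 2 * es.length := by
  induction es with
  | nil => rfl
  | cons e es ih => simp [pairWord] at ih ⊢; omega

/-- The output array holds two empty cells and then the pairs, and `rOut` the first free address. -/
structure Out (es : List (ℕ × ℕ)) (s : State) : Prop where
  ptr : s.reg rOut = 2 + 2 * es.length
  mem : ∀ i, s.mem ownArrs i = (0 :: 0 :: pairWord es).getD i 0

theorem Out.congr {es : List (ℕ × ℕ)} {s s' : State} (h : Out es s) (hr : s'.reg rOut = s.reg rOut)
    (hm : s'.mem ownArrs = s.mem ownArrs) : Out es s' :=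
  ⟨hr.trans h.ptr, fun i => hm ▸ h.mem i⟩

theorem Out.frame {es : List (ℕ × ℕ)} {p : Prog} {s s' : State} (h : Out es s) (hf : Frame p s s')
    (hp : rOut ∉ p.regs ∧ ownArrs ∉ p.arrs := by decide) : Out es s' :=
  h.congr (hf.reg _ hp.1) (hf.mem _ hp.2)

/-- Append the pair in registers `x` and `y` to the output. -/
def emit (x y : ℕ) : Prog :=
  .store ownArrs rOut x ;; .op .add rOut rOut rOne ;; .store ownArrs rOut y ;;
  .op .add rOut rOut rOne

theorem getD_append_pair (l : List ℕ) (x y i : ℕ) :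
    (l ++ [x, y]).getD i 0 =
      if i = l.length + 1 then y else if i = l.length then x else l.getD i 0 := by
  grind

theorem runs_emit {W x y : ℕ} {s : State} {es : List (ℕ × ℕ)} (h1 : s.reg rOne = 1)
    (h : Out es s) (hW : 2 * es.length + 4 ≤ W)
    (hx : x < ownRegs ∧ y < ownRegs ∧ x ≠ rOut ∧ y ≠ rOut := by decide) :
    Runs W (emit x y) s 4 (Out (es ++ [(s.reg x, s.reg y)])) := by
  have hp := h.ptr
  simp only [rOut, rOne] at hp h1 hx
  refine .step (.store (by decide) hx.1 ?_)
  refine .step (.add (by decide) (by decide) (by simp [hp, h1]; omega) ?_)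
  refine .step (.store (by decide) hx.2.1 ?_)
  refine .add (by decide) (by decide) (by simp [hp, h1]; omega) ?_
  refine ⟨by simp [hp, h1]; omega, fun i => ?_⟩
  have e : (0 :: 0 :: pairWord (es ++ [(s.reg x, s.reg y)])) =
      (0 :: 0 :: pairWord es) ++ [s.reg x, s.reg y] := by simp [pairWord]
  have e2 : (0 :: 0 :: pairWord es).length = 2 + 2 * es.length := by
    simp [length_pairWord]; omega
  rw [e, getD_append_pair, e2]
  have := h.mem i
  simp only [ownArrs] at this
  simp [hp, h1, hx, Function.update_apply, this]

end RAM

/-! ### The edges of the graph -/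

/-- The vertex in the first layer that stands for clause `0`, satisfied. -/
def chainBase (A : ℕ) : ℕ := 14 * A + 3

/-- The edges out of the half assignment `a`. -/
def edgesFrom (A M : ℕ) (u : ℕ → ℕ → ℕ) (a : ℕ) : List (ℕ × ℕ) :=
  [(a, 2 * A), (a, 2 * A + 1), (a, 2 * A + 2)] ++
    (List.range M).map fun c => (a, chainBase A + 2 * c + u a c)

/-- The edge, if any, from the last chain vertex of clause `c` to the second half assignment `b`. -/
def edgeTo (A M : ℕ) (v : ℕ → ℕ → ℕ) (b c : ℕ) : List (ℕ × ℕ) :=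
  if v b c = 0 then [] else [(chainBase A + 6 * M + 2 * c + 1, A + b)]

/-- The edges of the graph, for `A` half assignments on either side and `M` clauses; `u a c` and
`v b c` are `1` or `0` and tell whether the clause `c` is falsified by the first half assignment `a`
and by the second half assignment `b`. The vertices are numbered as follows: `a` is the first half
assignment `a`, `A + b` the second half assignment `b`, `2 * A + h` for `h < 3` a hub,
`2 * A + 3 + x` for `x < 12 * A` a dummy, of the hub `x / (4 * A)`, and
`chainBase A + 2 * M * i + 2 * c + f` for `i < 4` the vertex number `i` of the chain of clause `c`,
falsified (`f = 1`) or not (`f = 0`). Higher numbers are isolated vertices. -/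
def graphEdges (A M : ℕ) (u v : ℕ → ℕ → ℕ) : List (ℕ × ℕ) :=
  (List.range A).flatMap (edgesFrom A M u) ++
  (List.range A).flatMap (fun b => (List.range M).flatMap (edgeTo A M v b)) ++
  (List.range (12 * A)).map (fun x => (2 * A + x / (4 * A), 2 * A + 3 + x)) ++
  (List.range (6 * M)).map (fun x => (chainBase A + x, chainBase A + x + M + M))

theorem length_edgesFrom (A M : ℕ) (u : ℕ → ℕ → ℕ) (a : ℕ) :
    (edgesFrom A M u a).length = M + 3 := by
  simp [edgesFrom]

theorem length_flatMap_range_le {α : Type*} (f : ℕ → List α) (m B : ℕ)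
    (h : ∀ i < m, (f i).length ≤ B) : ((List.range m).flatMap f).length ≤ m * B := by
  induction m with
  | zero => simp
  | succ m ih =>
    rw [List.range_succ, List.flatMap_append, List.length_append, List.flatMap_singleton,
      Nat.succ_mul]
    exact Nat.add_le_add (ih fun i hi => h i (by omega)) (h m (by omega))

theorem length_edgeTo_le (A M : ℕ) (v : ℕ → ℕ → ℕ) (b c : ℕ) :
    (edgeTo A M v b c).length ≤ 1 := by
  rw [edgeTo]; split_ifs <;> simp

theorem length_graphEdges_le (A M : ℕ) (u v : ℕ → ℕ → ℕ) :
    (graphEdges A M u v).length ≤ 15 * A + 2 * (A * M) + 6 * M := by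
  have h₁ := length_flatMap_range_le (edgesFrom A M u) A (M + 3)
    fun i _ => (length_edgesFrom A M u i).le
  have h₂ := length_flatMap_range_le (fun b => (List.range M).flatMap (edgeTo A M v b)) A M
    fun b _ => (length_flatMap_range_le _ M 1 fun c _ => length_edgeTo_le A M v b c).trans (by simp)
  simp only [graphEdges, List.length_append, List.length_map, List.length_range]
  rw [Nat.mul_add] at h₁
  omega

/-- Whether the first half assignment `a` falsifies clause `c`. -/
def falsifiedFst (H : ℕ) (cs : List (List ℕ)) (a c : ℕ) : ℕ :=
  RAM.falsified (RAM.litTable 0 H a) (cs.getD c [])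

/-- Whether the second half assignment `b` falsifies clause `c`. -/
def falsifiedSnd (H : ℕ) (cs : List (List ℕ)) (b c : ℕ) : ℕ :=
  RAM.falsified (RAM.litTable H H b) (cs.getD c [])

namespace RAM

/-! ### The program that writes the graph -/

/-- The registers that stay constant once they are set up. -/
def ctxRegs : List ℕ := [rOne, rTwo, rZero, rM, rH, rA, rX, rHub]

/-- The constant registers hold what they should, and array `0` holds the formula. -/
structure Ctx (N H A : ℕ) (cs : List (List ℕ)) (s : State) : Prop where
  one : s.reg rOne = 1
  two : s.reg rTwo = 2
  zero : s.reg rZero = 0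
  m : s.reg rM = cs.length
  h : s.reg rH = H
  a : s.reg rA = A
  x : s.reg rX = chainBase A
  hub : s.reg rHub = 2 * A
  word : ∀ i, s.mem 0 i = (formulaWord N cs).getD i 0

theorem Ctx.congr {N H A : ℕ} {cs : List (List ℕ)} {s s' : State} (h : Ctx N H A cs s)
    (hr : ∀ r ∈ ctxRegs, s'.reg r = s.reg r) (hm : s'.mem 0 = s.mem 0) : Ctx N H A cs s' where
  one := (hr _ (by decide)).trans h.one
  two := (hr _ (by decide)).trans h.two
  zero := (hr _ (by decide)).trans h.zero
  m := (hr _ (by decide)).trans h.m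
  h := (hr _ (by decide)).trans h.h
  a := (hr _ (by decide)).trans h.a
  x := (hr _ (by decide)).trans h.x
  hub := (hr _ (by decide)).trans h.hub
  word i := by rw [hm, h.word]

theorem Ctx.frame {N H A : ℕ} {cs : List (List ℕ)} {p : Prog} {s s' : State}
    (h : Ctx N H A cs s) (hf : Frame p s s')
    (hp : (∀ r ∈ ctxRegs, r ∉ p.regs) ∧ 0 ∉ p.arrs := by decide) : Ctx N H A cs s' :=
  h.congr (fun r hr => hf.reg r (hp.1 r hr)) (hf.mem 0 hp.2)

theorem Ctx.setReg {N H A : ℕ} {cs : List (List ℕ)} {s : State} (h : Ctx N H A cs s) (r x : ℕ)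
    (hr : ∀ i ∈ ctxRegs, i ≠ r := by decide) : Ctx N H A cs (s.setReg r x) :=
  h.congr (fun i hi => by simp [hr i hi]) rfl

theorem Out.setReg {es : List (ℕ × ℕ)} {s : State} (h : Out es s) (r x : ℕ)
    (hr : rOut ≠ r := by decide) : Out es (s.setReg r x) :=
  h.congr (by rw [State.reg_setReg, if_neg hr]) rfl

/-- Array `j` is empty outside the block of literals that belongs to the given variables. -/
def EmptyOutside (j off H : ℕ) (s : State) : Prop :=
  ∀ l, ¬ (off ≤ l / 2 ∧ l / 2 < off + H) → s.mem j l = 0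

theorem EmptyOutside.of_eq {j off H a : ℕ} {s : State} (h : s.mem j = litTable off H a) :
    EmptyOutside j off H s := fun l hl => by rw [h, litTable_of_not_mem hl]

/-- A bound for all numbers that the programs below handle. -/
def maxNumber (N H A D : ℕ) (cs : List (List ℕ)) : ℕ :=
  (formulaWord N cs).length + 4 * H + (D + 2) * (15 * A + 2 * (A * cs.length) + 6 * cs.length) +
    14 * A + 8 * cs.length + D + N + 20

theorem maxNumber_bounds (N H A D : ℕ) (cs : List (List ℕ)) :
    (formulaWord N cs).length + 4 * H + D * (15 * A + 2 * (A * cs.length) + 6 * cs.length) +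
      44 * A + 4 * (A * cs.length) + 20 * cs.length + D + N + 20 ≤ maxNumber N H A D cs := by
  rw [maxNumber, Nat.add_mul D 2]
  omega

/-- For each clause, write the edge from the half assignment in register `rV`. -/
def writeEdgesFrom : Prog :=
  .const rPtr 2 ;;
  forLoop rC rKC rM (
    checkClause 1 ;;
    .op .add rT rC rC ;;
    .op .add rT rX rT ;;
    .op .add rT rT rFals ;;
    emit rV rT)

theorem falsified_le (tab : ℕ → ℕ) (C : List ℕ) : falsified tab C ≤ 1 := by
  rw [falsified]; split_ifs <;> omega

theorem clauseStart_zero (cs : List (List ℕ)) : clauseStart cs 0 = 2 := by simp [clauseStart]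

theorem runs_writeEdgesFrom {W N H A k a : ℕ} {cs : List (List ℕ)} {s : State}
    {es : List (ℕ × ℕ)} (hctx : Ctx N H A cs s) (hout : Out es s) (ha : s.reg rV = a)
    (htab : s.mem 1 = litTable 0 H a) (hk : ∀ C ∈ cs, C.length ≤ k)
    (hW : maxNumber N H A 0 cs ≤ W) (hes : 2 * es.length + 2 * cs.length + 4 ≤ W) :
    Runs W writeEdgesFrom s (cs.length * (8 * k + 16) + 4)
      (Out (es ++ (List.range cs.length).map
        fun c => (a, chainBase A + 2 * c + falsifiedFst H cs a c))) := by
  have hW' := maxNumber_bounds N H A 0 cs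
  refine .step (.const (by omega) ?_)
  refine Runs.forLoop (T := 8 * k + 13) cs.length (by simpa using hctx.m) (by simpa using hctx.one)
    (fun c s' => s'.reg rPtr = clauseStart cs c ∧
      Out (es ++ (List.range c).map fun c => (a, chainBase A + 2 * c + falsifiedFst H cs a c)) s')
    ⟨by simp [clauseStart_zero], by simpa using hout.setReg _ _⟩ ?_ (fun s' h _ => h.2)
    (fun c s' x y h => ⟨by simpa using h.1, (h.2.setReg _ _).setReg _ _⟩) le_rfl
  rintro c hc s' ⟨hptr, ho⟩ hi hf
  have hctx' : Ctx N H A cs s' := (hctx.setReg rPtr 2).frame hf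
  have hV : s'.reg rV = a := (hf.reg _ (by decide)).trans (by simpa using ha)
  have htab' : s'.mem 1 = litTable 0 H a := (hf.mem _ (by decide)).trans htab
  refine Runs.seq_frame (T' := 7) (runs_checkClause (.inl rfl) hctx'.one hctx'.word hc
    (hk _ (List.getElem_mem hc)) hptr (by omega)) (by omega) ?_
  rintro s₂ ⟨hptr₂, hu⟩ hf₂
  have hctx₂ := hctx'.frame hf₂
  have ho₂ := ho.frame hf₂
  have hV₂ := (hf₂.reg rV (by decide)).trans hV
  have hC₂ := (hf₂.reg rC (by decide)).trans hi
  have e1 := hctx₂.one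
  have ex := hctx₂.x
  have hu1 := falsified_le (s'.mem 1) cs[c]
  simp only [rFals, rV, rC, rX, rOne, rPtr] at hu hV₂ hC₂ ex e1 hptr₂
  have hb : chainBase A = 14 * A + 3 := rfl
  refine .step (.add (by decide) (by decide) (by simp [hC₂]; omega) ?_)
  refine .step (.add (by decide) (by decide) (by simp [hC₂, ex]; omega) ?_)
  refine .step (.add (by decide) (by decide) (by simp [hC₂, ex, hu]; omega) ?_)
  refine (runs_emit (by simp [e1]) (((ho₂.setReg _ _).setReg _ _).setReg _ _)
    (by simp; omega)).frame.mono le_rfl ?_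
  rintro s₃ ⟨h₃, hf₃⟩
  refine ⟨(hf₃.reg _ (by decide)).trans (by simp [hptr₂]), ?_⟩
  rw [List.range_succ, List.map_append, ← List.append_assoc]
  convert h₃ using 3
  simp [hV₂, hC₂, ex, hu, falsifiedFst, htab', hc]
  omega

/-- Write the edges out of all first half assignments. -/
def writeFirst : Prog :=
  forLoop rV rKV rA (
    expand 1 rV rZero ;;
    copy rT rHub ;;
    emit rV rT ;;
    .op .add rT rT rOne ;;
    emit rV rT ;;
    .op .add rT rT rOne ;;
    emit rV rT ;;
    writeEdgesFrom)

theorem runs_writeFirst {W N H A k : ℕ} {cs : List (List ℕ)} {s : State}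
    (hctx : Ctx N H A cs s) (hout : Out [] s)
    (htab : EmptyOutside 1 0 H s) (hk : ∀ C ∈ cs, C.length ≤ k)
    (hW : maxNumber N H A 0 cs ≤ W) :
    Runs W writeFirst s (A * (H * 13 + cs.length * (8 * k + 16) + 30) + 3)
      fun s' => Out ((List.range A).flatMap (edgesFrom A cs.length (falsifiedFst H cs))) s' ∧
        EmptyOutside 1 0 H s' := by
  have hW' := maxNumber_bounds N H A 0 cs
  refine Runs.forLoop (T := H * 13 + cs.length * (8 * k + 16) + 27) A hctx.a hctx.one
    (fun a s' => Out ((List.range a).flatMap (edgesFrom A cs.length (falsifiedFst H cs))) s' ∧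
        EmptyOutside 1 0 H s')
    ⟨by simpa using hout, htab⟩ ?_ (fun s' h _ => h)
    (fun c s' x y h => ⟨(h.1.setReg _ _).setReg _ _, h.2⟩) le_rfl
  rintro a ha s₁ ⟨ho₁, he₁⟩ hV₁ hf₁
  have hctx₁ : Ctx N H A cs s₁ := hctx.frame hf₁
  have hlen := length_flatMap_range_le (edgesFrom A cs.length (falsifiedFst H cs)) a
    (cs.length + 3) fun i _ => (length_edgesFrom _ _ _ i).le
  have hmul := Nat.mul_le_mul_right (cs.length + 3) (Nat.succ_le_of_lt ha)
  rw [Nat.succ_mul, Nat.mul_add A] at hmul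
  set es := (List.range a).flatMap (edgesFrom A cs.length (falsifiedFst H cs)) with hes
  refine Runs.seq_frame (T' := cs.length * (8 * k + 16) + 19)
    (runs_expand (.inl rfl) (.inl rfl) hctx₁.one hctx₁.two hctx₁.h hctx₁.zero (by omega)
      (by rw [hV₁]; omega) he₁) (by omega) ?_
  intro s₂ htab₂ hf₂
  rw [hV₁] at htab₂
  have hctx₂ := hctx₁.frame hf₂
  have ho₂ := ho₁.frame hf₂
  have hV₂ : s₂.reg rV = a := (hf₂.reg _ (by decide)).trans hV₁
  have ehub := hctx₂.hub
  refine .step (.copy (by decide) hctx₂.one ?_)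
  have hctx₃ := hctx₂.setReg rT (s₂.reg rHub)
  refine Runs.seq_frame (T' := cs.length * (8 * k + 16) + 14)
    (runs_emit hctx₃.one (ho₂.setReg _ _) (by omega)) (by omega) ?_
  intro s₄ ho₄ hf₄
  have hctx₄ := hctx₃.frame hf₄
  have e1 := hctx₄.one
  have hV₄ : s₄.reg rV = a := (hf₄.reg _ (by decide)).trans (by simpa using hV₂)
  have hT₄ : s₄.reg rT = 2 * A := (hf₄.reg _ (by decide)).trans (by simpa using ehub)
  simp only [rOne, rT] at e1 hT₄
  refine .step (.add (by decide) (by decide) (by simp [e1, hT₄]; omega) ?_)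
  have hctx₅ := hctx₄.setReg rT (s₄.reg rT + s₄.reg rOne)
  refine Runs.seq_frame (T' := cs.length * (8 * k + 16) + 9)
    (runs_emit hctx₅.one (ho₄.setReg _ _) (by simp; omega)) (by omega) ?_
  intro s₆ ho₆ hf₆
  have hctx₆ := hctx₅.frame hf₆
  have e1' := hctx₆.one
  have hV₆ : s₆.reg rV = a := (hf₆.reg _ (by decide)).trans (by simpa using hV₄)
  have hT₆ : s₆.reg rT = 2 * A + 1 := (hf₆.reg _ (by decide)).trans (by simp [hT₄, e1])
  simp only [rOne, rT] at e1' hT₆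
  refine .step (.add (by decide) (by decide) (by simp [e1', hT₆]; omega) ?_)
  have hctx₇ := hctx₆.setReg rT (s₆.reg rT + s₆.reg rOne)
  refine Runs.seq_frame (T' := cs.length * (8 * k + 16) + 4)
    (runs_emit hctx₇.one (ho₆.setReg _ _) (by simp; omega)) (by omega) ?_
  intro s₈ ho₈ hf₈
  have hctx₈ := hctx₇.frame hf₈
  have hV₈ : s₈.reg rV = a := (hf₈.reg _ (by decide)).trans (by simpa using hV₆)
  have htab₈ : s₈.mem 1 = litTable 0 H a := by
    rw [← htab₂, hf₈.mem _ (by decide), State.mem_setReg, hf₆.mem _ (by decide),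
      State.mem_setReg, hf₄.mem _ (by decide), State.mem_setReg]
  refine (runs_writeEdgesFrom hctx₈ ho₈ hV₈ htab₈ hk hW (by simp; omega)).frame.mono le_rfl ?_
  rintro s₉ ⟨ho₉, hf₉⟩
  refine ⟨?_, .of_eq ((hf₉.mem _ (by decide)).trans htab₈)⟩
  rw [List.range_succ, List.flatMap_append, List.flatMap_singleton]
  convert ho₉ using 1
  simp [edgesFrom, ← hes, hV₂, hV₄, hV₆, hT₄, hT₆, e1, e1', ehub]

/-- For each clause that the half assignment in register `rV` falsifies, write the edge to it. -/
def writeEdgesTo : Prog :=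
  .const rPtr 2 ;;
  forLoop rC rKC rM (
    checkClause 2 ;;
    .ite rFals (
      .const rT 6 ;;
      .op .mul rT rT rM ;;
      .op .add rT rX rT ;;
      .op .add rU rC rC ;;
      .op .add rT rT rU ;;
      .op .add rT rT rOne ;;
      .op .add rU rA rV ;;
      emit rT rU) .skip)

theorem runs_writeEdgesTo {W N H A k b : ℕ} {cs : List (List ℕ)} {s : State}
    {es : List (ℕ × ℕ)} (hctx : Ctx N H A cs s) (hout : Out es s) (hb : s.reg rV = b) (hbA : b ≤ A)
    (htab : s.mem 2 = litTable H H b) (hk : ∀ C ∈ cs, C.length ≤ k)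
    (hW : maxNumber N H A 0 cs ≤ W) (hes : 2 * es.length + 2 * cs.length + 4 ≤ W) :
    Runs W writeEdgesTo s (cs.length * (8 * k + 21) + 4)
      (Out (es ++ (List.range cs.length).flatMap
        (edgeTo A cs.length (falsifiedSnd H cs) b))) := by
  have hW' := maxNumber_bounds N H A 0 cs
  refine .step (.const (by omega) ?_)
  refine Runs.forLoop (T := 8 * k + 18) cs.length (by simpa using hctx.m) (by simpa using hctx.one)
    (fun c s' => s'.reg rPtr = clauseStart cs c ∧
      Out (es ++ (List.range c).flatMap (edgeTo A cs.length (falsifiedSnd H cs) b)) s')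
    ⟨by simp [clauseStart_zero], by simpa using hout.setReg _ _⟩ ?_ (fun s' h _ => h.2)
    (fun c s' x y h => ⟨by simpa using h.1, (h.2.setReg _ _).setReg _ _⟩) le_rfl
  rintro c hc s' ⟨hptr, ho⟩ hi hf
  have hctx' : Ctx N H A cs s' := (hctx.setReg rPtr 2).frame hf
  have hV : s'.reg rV = b := (hf.reg _ (by decide)).trans (by simpa using hb)
  have htab' : s'.mem 2 = litTable H H b := (hf.mem _ (by decide)).trans htab
  have hlen := length_flatMap_range_le (edgeTo A cs.length (falsifiedSnd H cs) b) c 1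
    fun i _ => length_edgeTo_le _ _ _ _ i
  refine Runs.seq_frame (T' := 12) (runs_checkClause (.inr rfl) hctx'.one hctx'.word hc
    (hk _ (List.getElem_mem hc)) hptr (by omega)) (by omega) ?_
  rintro s₂ ⟨hptr₂, hu⟩ hf₂
  have hctx₂ := hctx'.frame hf₂
  have ho₂ := ho.frame hf₂
  have hV₂ := (hf₂.reg rV (by decide)).trans hV
  have hC₂ := (hf₂.reg rC (by decide)).trans hi
  have e1 := hctx₂.one
  have ex := hctx₂.x
  have em := hctx₂.m
  have ea := hctx₂.a
  have hu' : s₂.reg rFals = falsifiedSnd H cs b c := by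
    rw [hu, falsifiedSnd, htab', List.getD_eq_getElem _ _ hc]
  simp only [rV, rC, rX, rOne, rPtr, rM, rA] at hV₂ hC₂ ex e1 hptr₂ em ea
  have hbase : chainBase A = 14 * A + 3 := rfl
  rw [List.range_succ, List.flatMap_append, ← List.append_assoc, List.flatMap_singleton, edgeTo,
    ← hu']
  refine .ite (by decide) (fun h => ?_) (fun h => .skip ?_)
  · rw [if_neg h]
    refine .step (.const (by omega) ?_)
    refine .step (.mul (by decide) (by decide) (by simp [em]; omega) ?_)
    refine .step (.add (by decide) (by decide) (by simp [em, ex]; omega) ?_)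
    refine .step (.add (by decide) (by decide) (by simp [hC₂]; omega) ?_)
    refine .step (.add (by decide) (by decide) (by simp [em, ex, hC₂]; omega) ?_)
    refine .step (.add (by decide) (by decide) (by simp [em, ex, hC₂, e1]; omega) ?_)
    refine .step (.add (by decide) (by decide) (by simp [ea, hV₂]; omega) ?_)
    refine (runs_emit (by simp [e1]) (((((((ho₂.setReg _ _).setReg _ _).setReg _ _).setReg _
      _).setReg _ _).setReg _ _).setReg _ _) (by simp at hlen ⊢; omega)).frame.mono (by omega) ?_
    rintro s₃ ⟨h₃, hf₃⟩
    refine ⟨(hf₃.reg _ (by decide)).trans (by simp [hptr₂]), ?_⟩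
    convert h₃ using 3
    simp [hV₂, hC₂, ex, em, ea, e1]
    omega
  · rw [if_pos h, List.append_nil]
    exact ⟨hptr₂, ho₂⟩

/-- Write the edges into all second half assignments. -/
def writeSecond : Prog :=
  forLoop rV rKV rA (expand 2 rV rH ;; writeEdgesTo)

theorem runs_writeSecond {W N H A k : ℕ} {cs : List (List ℕ)} {s : State} {es : List (ℕ × ℕ)}
    (hctx : Ctx N H A cs s) (hout : Out es s)
    (htab : EmptyOutside 2 H H s) (hk : ∀ C ∈ cs, C.length ≤ k)
    (hW : maxNumber N H A 0 cs ≤ W) (hes : es.length ≤ 3 * A + A * cs.length) :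
    Runs W writeSecond s (A * (H * 13 + cs.length * (8 * k + 21) + 11) + 3)
      fun s' => Out (es ++ (List.range A).flatMap fun b => (List.range cs.length).flatMap
        (edgeTo A cs.length (falsifiedSnd H cs) b)) s' ∧ EmptyOutside 2 H H s' := by
  have hW' := maxNumber_bounds N H A 0 cs
  refine Runs.forLoop (T := H * 13 + cs.length * (8 * k + 21) + 8) A hctx.a hctx.one
    (fun a s' => Out (es ++ (List.range a).flatMap fun b => (List.range cs.length).flatMap
        (edgeTo A cs.length (falsifiedSnd H cs) b)) s' ∧ EmptyOutside 2 H H s')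
    ⟨by simpa using hout, htab⟩ ?_ (fun s' h _ => h)
    (fun c s' x y h => ⟨(h.1.setReg _ _).setReg _ _, h.2⟩) le_rfl
  rintro b hb s₁ ⟨ho₁, he₁⟩ hV₁ hf₁
  have hctx₁ : Ctx N H A cs s₁ := hctx.frame hf₁
  have hlen := length_flatMap_range_le (fun b => (List.range cs.length).flatMap
    (edgeTo A cs.length (falsifiedSnd H cs) b)) b cs.length
    fun b _ => (length_flatMap_range_le _ _ 1 fun c _ => length_edgeTo_le _ _ _ b c).trans
      (by simp)
  have hmul := Nat.mul_le_mul_right cs.length (Nat.succ_le_of_lt hb)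
  rw [Nat.succ_mul] at hmul
  refine Runs.seq_frame (T' := cs.length * (8 * k + 21) + 4)
    (runs_expand (.inl rfl) (.inr rfl) hctx₁.one hctx₁.two hctx₁.h hctx₁.h (by omega)
      (by rw [hV₁]; omega) he₁) (by omega) ?_
  intro s₂ htab₂ hf₂
  rw [hV₁] at htab₂
  refine (runs_writeEdgesTo (hctx₁.frame hf₂) (ho₁.frame hf₂) ((hf₂.reg _ (by decide)).trans hV₁)
    hb.le htab₂ hk hW (by rw [List.length_append]; omega)).frame.mono le_rfl ?_
  rintro s₃ ⟨ho₃, hf₃⟩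
  refine ⟨?_, .of_eq ((hf₃.mem _ (by decide)).trans htab₂)⟩
  rwa [List.range_succ, List.flatMap_append, List.flatMap_singleton, ← List.append_assoc]

/-- Write the edges out of the hubs. -/
def writeHubs : Prog :=
  .const rT 12 ;;
  .op .mul rL rT rA ;;
  forLoop rV rKV rL (
    .const rT 4 ;;
    .op .mul rT rT rA ;;
    .op .div rT rV rT ;;
    .op .add rT rHub rT ;;
    .const rU 3 ;;
    .op .add rU rHub rU ;;
    .op .add rU rU rV ;;
    emit rT rU)

theorem runs_writeHubs {W N H A : ℕ} {cs : List (List ℕ)} {s : State} {es : List (ℕ × ℕ)}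
    (hctx : Ctx N H A cs s) (hout : Out es s) (hW : maxNumber N H A 0 cs ≤ W)
    (hes : es.length ≤ 3 * A + 2 * (A * cs.length)) :
    Runs W writeHubs s (12 * A * 14 + 5)
      (Out (es ++ (List.range (12 * A)).map fun x => (2 * A + x / (4 * A), 2 * A + 3 + x))) := by
  have hW' := maxNumber_bounds N H A 0 cs
  have ea := hctx.a
  have e1 := hctx.one
  have eh := hctx.hub
  simp only [rA, rOne, rHub] at ea e1 eh
  refine .step (.const (by omega) ?_)
  refine .step (.mul (by decide) (by decide) (by simp [ea]; omega) ?_)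
  refine Runs.forLoop (T := 11) (12 * A) (by simp [ea]) (by simp [e1])
    (fun a s' => Out (es ++ (List.range a).map
      fun x => (2 * A + x / (4 * A), 2 * A + 3 + x)) s')
    (by simpa using (hout.setReg _ _).setReg _ _) ?_ (fun s' h _ => h)
    (fun c s' x y h => (h.setReg _ _).setReg _ _) le_rfl
  rintro x hx s₁ ho₁ hV₁ hf₁
  have ea₁ : s₁.reg 4 = A := (hf₁.reg _ (by decide)).trans (by simp [ea])
  have e1₁ : s₁.reg 1 = 1 := (hf₁.reg _ (by decide)).trans (by simp [e1])
  have eh₁ : s₁.reg 27 = 2 * A := (hf₁.reg _ (by decide)).trans (by simp [eh])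
  simp only [rV] at hV₁
  have hdiv := Nat.div_le_self x (4 * A)
  refine .step (.const (by omega) ?_)
  refine .step (.mul (by decide) (by decide) (by simp [ea₁]; omega) ?_)
  refine .step (.div (by decide) (by decide) ?_)
  refine .step (.add (by decide) (by decide) (by simp [eh₁, hV₁, ea₁]; omega) ?_)
  refine .step (.const (by omega) ?_)
  refine .step (.add (by decide) (by decide) (by simp [eh₁]; omega) ?_)
  refine .step (.add (by decide) (by decide) (by simp [eh₁, hV₁]; omega) ?_)
  refine (runs_emit (by simp [e1₁]) (((((((ho₁.setReg _ _).setReg _ _).setReg _ _).setReg _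
      _).setReg _ _).setReg _ _).setReg _ _) (by simp; omega)).mono (by omega) ?_
  intro s₃ h₃
  rw [List.range_succ, List.map_append, ← List.append_assoc]
  convert h₃ using 3
  simp [hV₁, ea₁, eh₁]

/-- Write the edges along the chains. -/
def writeChains : Prog :=
  .const rT 6 ;;
  .op .mul rL rT rM ;;
  forLoop rV rKV rL (
    .op .add rT rX rV ;;
    .op .add rU rT rM ;;
    .op .add rU rU rM ;;
    emit rT rU)

theorem runs_writeChains {W N H A : ℕ} {cs : List (List ℕ)} {s : State} {es : List (ℕ × ℕ)}
    (hctx : Ctx N H A cs s) (hout : Out es s) (hW : maxNumber N H A 0 cs ≤ W)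
    (hes : es.length ≤ 15 * A + 2 * (A * cs.length)) :
    Runs W writeChains s (6 * cs.length * 10 + 5)
      (Out (es ++ (List.range (6 * cs.length)).map
        fun x => (chainBase A + x, chainBase A + x + cs.length + cs.length))) := by
  have hW' := maxNumber_bounds N H A 0 cs
  have em := hctx.m
  have e1 := hctx.one
  have ex := hctx.x
  have hbase : chainBase A = 14 * A + 3 := rfl
  simp only [rM, rOne, rX] at em e1 ex
  refine .step (.const (by omega) ?_)
  refine .step (.mul (by decide) (by decide) (by simp [em]; omega) ?_)
  refine Runs.forLoop (T := 7) (6 * cs.length) (by simp [em]) (by simp [e1])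
    (fun a s' => Out (es ++ (List.range a).map
      fun x => (chainBase A + x, chainBase A + x + cs.length + cs.length)) s')
    (by simpa using (hout.setReg _ _).setReg _ _) ?_ (fun s' h _ => h)
    (fun c s' x y h => (h.setReg _ _).setReg _ _) le_rfl
  rintro x hx s₁ ho₁ hV₁ hf₁
  have em₁ : s₁.reg 2 = cs.length := (hf₁.reg _ (by decide)).trans (by simp [em])
  have e1₁ : s₁.reg 1 = 1 := (hf₁.reg _ (by decide)).trans (by simp [e1])
  have ex₁ : s₁.reg 5 = chainBase A := (hf₁.reg _ (by decide)).trans (by simp [ex])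
  simp only [rV] at hV₁
  refine .step (.add (by decide) (by decide) (by simp [ex₁, hV₁]; omega) ?_)
  refine .step (.add (by decide) (by decide) (by simp [ex₁, hV₁, em₁]; omega) ?_)
  refine .step (.add (by decide) (by decide) (by simp [ex₁, hV₁, em₁]; omega) ?_)
  refine (runs_emit (by simp [e1₁]) (((ho₁.setReg _ _).setReg _ _).setReg _ _)
    (by simp; omega)).mono (by omega) ?_
  intro s₃ h₃
  rw [List.range_succ, List.map_append, ← List.append_assoc]
  convert h₃ using 3
  simp [hV₁, em₁, ex₁]

/-- The number of vertices of the graph: a multiple of the number `m` of edges, as isolated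
vertices, on top of the ones that the edges need. -/
def numVertices (D A M m : ℕ) : ℕ := chainBase A + 8 * M + m * D

/-- Write the numbers of vertices and edges. -/
def writeHeader (D : ℕ) : Prog :=
  .op .sub rT rOut rTwo ;;
  .op .div rT rT rTwo ;;
  .store ownArrs rOne rT ;;
  .const rU D ;;
  .op .mul rT rT rU ;;
  .const rU 8 ;;
  .op .mul rU rU rM ;;
  .op .add rU rX rU ;;
  .op .add rT rU rT ;;
  .store ownArrs rZero rT

theorem runs_writeHeader {W N H A D : ℕ} {cs : List (List ℕ)} {s : State} {es : List (ℕ × ℕ)}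
    (hctx : Ctx N H A cs s) (hout : Out es s) (hW : maxNumber N H A D cs ≤ W)
    (hes : es.length ≤ 15 * A + 2 * (A * cs.length) + 6 * cs.length) :
    Runs W (writeHeader D) s 10 fun s' => ∀ i, s'.mem ownArrs i =
      (numVertices D A cs.length es.length :: es.length :: pairWord es).getD i 0 := by
  have hW' := maxNumber_bounds N H A D cs
  have hbase : chainBase A = 14 * A + 3 := rfl
  have hmul := Nat.mul_le_mul_left D hes
  rw [mul_comm D] at hmul
  have e1 := hctx.one
  have e2 := hctx.two
  have em := hctx.m
  have ex := hctx.x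
  have e0 := hctx.zero
  have eo := hout.ptr
  simp only [rM, rOne, rX, rZero, rTwo, rOut] at em e1 ex e0 e2 eo
  refine .step (.sub (by decide) (by decide) ?_)
  refine .step (.div (by decide) (by decide) ?_)
  refine .step (.store (by decide) (by decide) ?_)
  refine .step (.const (by omega) ?_)
  refine .step (.mul (by decide) (by decide) (by simp [eo, e2]; omega) ?_)
  refine .step (.const (by omega) ?_)
  refine .step (.mul (by decide) (by decide) (by simp [em]; omega) ?_)
  refine .step (.add (by decide) (by decide) (by simp [em, ex]; omega) ?_)
  refine .step (.add (by decide) (by decide) (by simp [em, ex, eo, e2]; omega) ?_)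
  refine .store (by decide) (by decide) ?_
  intro i
  have hi := hout.mem i
  simp only [ownArrs] at hi
  simp [em, ex, eo, e2, e1, e0, Function.update_apply, hi, numVertices]
  rcases i with _ | _ | i <;> simp

/-- Set up the constant registers. -/
def setup : Prog :=
  .const rOne 1 ;;
  .const rTwo 2 ;;
  .load rN 0 rZero ;;
  .load rM 0 rOne ;;
  .op .add rH rN rOne ;;
  .op .div rH rH rTwo ;;
  .const rA 1 ;;
  forLoop rI rK rH (.op .mul rA rA rTwo) ;;
  .const rTmp 14 ;;
  .op .mul rX rTmp rA ;;
  .const rTmp 3 ;;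
  .op .add rX rX rTmp ;;
  .op .mul rHub rTwo rA ;;
  .const rOut 2

theorem runs_setup {W N H : ℕ} {cs : List (List ℕ)}
    (hH : (N + 1) / 2 = H) (hW : maxNumber N H (2 ^ H) 0 cs ≤ W) :
    Runs W setup (init (formulaWord N cs)) (H * 4 + 16)
      fun s' => Ctx N H (2 ^ H) cs s' ∧ Out [] s' ∧ s'.mem = (init (formulaWord N cs)).mem := by
  have hW' := maxNumber_bounds N H (2 ^ H) 0 cs
  have hreg : ∀ r, (init (formulaWord N cs)).reg r = 0 := fun _ => rfl
  have hm0 : ∀ i, (init (formulaWord N cs)).mem 0 i = (formulaWord N cs).getD i 0 := fun _ => rfl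
  have hmem : ∀ j, j ≠ 0 → ∀ i, (init (formulaWord N cs)).mem j i = 0 := fun j hj i => by
    simp [init, hj]
  have hn : (init (formulaWord N cs)).mem 0 0 = N := rfl
  have hm : (init (formulaWord N cs)).mem 0 1 = cs.length := rfl
  set s := init (formulaWord N cs)
  refine .step (.const (by omega) ?_)
  refine .step (.const (by omega) ?_)
  refine .step (.load (by decide) (by decide) ?_)
  refine .step (.load (by decide) (by decide) ?_)
  refine .step (.add (by decide) (by decide) (by simp [hreg, hn]; omega) ?_)
  refine .step (.div (by decide) (by decide) ?_)
  refine .step (.const (by omega) ?_)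
  refine Runs.seq_frame (T := H * 4 + 3) (T' := 6) (P := fun s' => s'.reg rA = 2 ^ H)
    (Runs.forLoop (T := 1) H (by simp [hreg, hn, hH]) (by simp)
    (fun j s' => s'.reg rA = 2 ^ j) (by simp) ?_ (fun s' h _ => h) ?_ le_rfl) (by omega) ?_
  · intro j hj s' hA hi hf
    have e2 : s'.reg 6 = 2 := (hf.reg _ (by decide)).trans (by simp)
    have hpow := Nat.pow_le_pow_right (n := 2) (by norm_num) (Nat.succ_le_of_lt hj)
    rw [pow_succ] at hpow
    simp only [rA] at hA
    refine .mul (by decide) (by decide) ?_ ?_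
    · simp [e2, hA]; omega
    · simp [e2, hA, pow_succ]
  · intro j s' x y h
    simpa using h
  · intro s₁ hA hf
    have e1 : s₁.reg 1 = 1 := (hf.reg _ (by decide)).trans (by simp)
    have e2 : s₁.reg 6 = 2 := (hf.reg _ (by decide)).trans (by simp)
    have e0 : s₁.reg 24 = 0 := (hf.reg _ (by decide)).trans (by simp [hreg])
    have em : s₁.reg 2 = cs.length := (hf.reg _ (by decide)).trans (by simp [hm])
    have eh : s₁.reg 3 = H := (hf.reg _ (by decide)).trans (by simp [hreg, hn, hH])
    have emem : s₁.mem = s.mem := by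
      funext j
      exact (hf.mem _ (by simp [Prog.arrs, forLoop, copy])).trans rfl
    simp only [rA] at hA
    refine .step (.const (by omega) ?_)
    refine .step (.mul (by decide) (by decide) (by simp [hA]; omega) ?_)
    refine .step (.const (by omega) ?_)
    refine .step (.add (by decide) (by decide) (by simp [hA]; omega) ?_)
    refine .step (.mul (by decide) (by decide) (by simp [hA, e2]; omega) ?_)
    refine .const (by omega) ?_
    refine ⟨⟨?_, ?_, ?_, ?_, ?_, ?_, ?_, ?_, ?_⟩, ⟨?_, ?_⟩, ?_⟩
    · simp [e1]
    · simp [e2]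
    · simp [e0]
    · simp [em]
    · simp [eh]
    · simp [hA]
    · simp [hA, chainBase]
    · simp [hA, e2]
    · simp [emem, hm0]
    · simp
    · intro i
      simp only [State.mem_setReg, emem, hmem ownArrs (by decide)]
      rcases i with _ | _ | i <;> simp [pairWord]
    · simpa using emem

/-- Write the graph. -/
def buildGraph (D : ℕ) : Prog :=
  setup ;; writeFirst ;; writeSecond ;; writeHubs ;; writeChains ;; writeHeader D

/-- The graph as a word. -/
def graphWord (D A : ℕ) (cs : List (List ℕ)) (es : List (ℕ × ℕ)) : List ℕ :=
  numVertices D A cs.length es.length :: es.length :: pairWord es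

theorem runs_buildGraph {W N H k D : ℕ} {cs : List (List ℕ)} (hk : ∀ C ∈ cs, C.length ≤ k)
    (hH : (N + 1) / 2 = H) (hW : maxNumber N H (2 ^ H) D cs ≤ W) :
    Runs W (buildGraph D) (init (formulaWord N cs))
      (2 ^ H * (H * 26 + cs.length * (16 * k + 37) + 209) + H * 4 + 60 * cs.length + 42)
      fun s' => Ctx N H (2 ^ H) cs s' ∧ EmptyOutside 1 0 H s' ∧ EmptyOutside 2 H H s' ∧
        ∀ i, s'.mem ownArrs i = (graphWord D (2 ^ H) cs
          (graphEdges (2 ^ H) cs.length (falsifiedFst H cs) (falsifiedSnd H cs))).getD i 0 := by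
  have hW0 : maxNumber N H (2 ^ H) 0 cs ≤ W := by
    refine le_trans ?_ hW
    rw [maxNumber, maxNumber, Nat.add_mul, Nat.add_mul]; omega
  have hempty : ∀ j, j ≠ 0 → ∀ i, (init (formulaWord N cs)).mem j i = 0 := fun j hj i => by
    simp [init, hj]
  have hlen := length_graphEdges_le (2 ^ H) cs.length (falsifiedFst H cs) (falsifiedSnd H cs)
  have hlen₁ := length_flatMap_range_le (edgesFrom (2 ^ H) cs.length (falsifiedFst H cs)) (2 ^ H)
    (cs.length + 3) fun i _ => (length_edgesFrom _ _ _ i).le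
  have hlen₂ := length_flatMap_range_le (fun b => (List.range cs.length).flatMap
    (edgeTo (2 ^ H) cs.length (falsifiedSnd H cs) b)) (2 ^ H) cs.length
    fun b _ => (length_flatMap_range_le _ _ 1 fun c _ => length_edgeTo_le _ _ _ b c).trans
      (by simp)
  rw [Nat.mul_add] at hlen₁
  have hT : 2 ^ H * (H * 26 + cs.length * (16 * k + 37) + 209) =
      2 ^ H * (H * 13 + cs.length * (8 * k + 16) + 30) +
      2 ^ H * (H * 13 + cs.length * (8 * k + 21) + 11) + 12 * 2 ^ H * 14 := by ring
  rw [hT]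
  generalize ht₁ : 2 ^ H * (H * 13 + cs.length * (8 * k + 16) + 30) = t₁
  generalize ht₂ : 2 ^ H * (H * 13 + cs.length * (8 * k + 21) + 11) = t₂
  refine Runs.seq_frame (T' := t₁ + 3 + (t₂ + 3 + (12 * 2 ^ H * 14 + 5 +
    (6 * cs.length * 10 + 5 + 10)))) (runs_setup hH hW0) (by omega) ?_
  rintro s₁ ⟨hctx₁, ho₁, hmem₁⟩ -
  refine Runs.seq_frame (T' := t₂ + 3 + (12 * 2 ^ H * 14 + 5 + (6 * cs.length * 10 + 5 + 10)))
    (runs_writeFirst hctx₁ ho₁ (fun l _ => by rw [hmem₁, hempty 1 (by decide)]) hk hW0)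
    (by rw [ht₁]) ?_
  rintro s₂ ⟨ho₂, he₂⟩ hf₂
  have hctx₂ := hctx₁.frame hf₂
  refine Runs.seq_frame (T' := 12 * 2 ^ H * 14 + 5 + (6 * cs.length * 10 + 5 + 10))
    (runs_writeSecond hctx₂ ho₂
      (fun l _ => by rw [hf₂.mem 2 (by decide), hmem₁, hempty 2 (by decide)]) hk hW0 (by omega))
    (by rw [ht₂]) ?_
  rintro s₃ ⟨ho₃, he₃⟩ hf₃
  have hctx₃ := hctx₂.frame hf₃
  refine Runs.seq_frame (T' := 6 * cs.length * 10 + 5 + 10)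
    (runs_writeHubs hctx₃ ho₃ hW0 (by rw [List.length_append]; omega)) le_rfl ?_
  intro s₄ ho₄ hf₄
  have hctx₄ := hctx₃.frame hf₄
  refine Runs.seq_frame (T' := 10)
    (runs_writeChains hctx₄ ho₄ hW0 (by
      rw [List.length_append, List.length_append, List.length_map, List.length_range]; omega))
    le_rfl ?_
  intro s₅ ho₅ hf₅
  have hctx₅ := hctx₄.frame hf₅
  refine (runs_writeHeader hctx₅ ho₅ hW hlen).frame.mono le_rfl ?_
  rintro s₆ ⟨hw, hf₆⟩
  have hregs : (∀ r ∈ ctxRegs, r ∉ (writeHeader D).regs) ∧ 0 ∉ (writeHeader D).arrs := by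
    simp [writeHeader, Prog.regs, Prog.arrs, ctxRegs]
  refine ⟨hctx₅.frame hf₆ hregs, fun l hl => ?_, fun l hl => ?_, hw⟩
  · rw [hf₆.mem 1 (by simp [writeHeader, Prog.arrs]), hf₅.mem 1 (by decide),
      hf₄.mem 1 (by decide), hf₃.mem 1 (by decide), he₂ l hl]
  · rw [hf₆.mem 2 (by simp [writeHeader, Prog.arrs]), hf₅.mem 2 (by decide),
      hf₄.mem 2 (by decide), he₃ l hl]

/-! ### The program that tries all second half assignments -/

/-- Set `rOk` to `0` if some clause is falsified by both half assignments. -/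
def checkAll : Prog :=
  .const rOk 1 ;;
  .const rPtr 2 ;;
  forLoop rC rKC rM (
    copy rStart rPtr ;;
    checkClause 1 ;;
    copy rU rFals ;;
    copy rPtr rStart ;;
    checkClause 2 ;;
    .op .mul rU rU rFals ;;
    .ite rU (.const rOk 0) .skip)

theorem runs_checkAll {W N H A k a b : ℕ} {cs : List (List ℕ)} {s : State}
    (hctx : Ctx N H A cs s) (htab₁ : s.mem 1 = litTable 0 H a) (htab₂ : s.mem 2 = litTable H H b)
    (hk : ∀ C ∈ cs, C.length ≤ k) (hW : maxNumber N H A 0 cs ≤ W) :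
    Runs W checkAll s (cs.length * (16 * k + 21) + 5) fun s' => s'.reg rOk =
      if ∀ c < cs.length, falsifiedFst H cs a c * falsifiedSnd H cs b c = 0 then 1 else 0 := by
  have hW' := maxNumber_bounds N H A 0 cs
  refine .step (.const (by omega) (.step (.const (by omega) ?_)))
  refine Runs.forLoop (T := 16 * k + 18) cs.length (by simpa using hctx.m) (by simpa using hctx.one)
    (fun c s' => s'.reg rPtr = clauseStart cs c ∧ s'.reg rOk =
      if ∀ i < c, falsifiedFst H cs a i * falsifiedSnd H cs b i = 0 then 1 else 0)
    ⟨by simp [clauseStart_zero], by simp⟩ ?_ (fun s' h _ => h.2)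
    (fun c s' x y h => ⟨by simpa using h.1, by simpa using h.2⟩) le_rfl
  rintro c hc s₁ ⟨hptr, hok⟩ hi hf
  have hctx₁ : Ctx N H A cs s₁ := ((hctx.setReg rOk 1).setReg rPtr 2).frame hf
  have htab₁' : s₁.mem 1 = litTable 0 H a := (hf.mem _ (by decide)).trans htab₁
  have htab₂' : s₁.mem 2 = litTable H H b := (hf.mem _ (by decide)).trans htab₂
  have hget : cs.getD c [] = cs[c] := List.getD_eq_getElem _ _ hc
  refine .step (.copy (by decide) hctx₁.one ?_)
  have hctx₁' := hctx₁.setReg rStart (s₁.reg rPtr)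
  refine Runs.seq_frame (T' := 8 * k + 11) (runs_checkClause (.inl rfl) hctx₁'.one hctx₁'.word hc
    (hk _ (List.getElem_mem hc)) (by simpa using hptr) (by omega)) (by omega) ?_
  rintro s₂ ⟨-, hu⟩ hf₂
  have hctx₂ := hctx₁'.frame hf₂
  have hu₂ : s₂.reg rFals = falsifiedFst H cs a c := by
    rw [hu, falsifiedFst, hget, State.mem_setReg, htab₁']
  have hstart₂ : s₂.reg rStart = clauseStart cs c := by
    rw [hf₂.reg _ (by decide), ← hptr]; simp
  have hok₂ : s₂.reg rOk = s₁.reg rOk := by rw [hf₂.reg _ (by decide)]; simp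
  refine .step (.copy (by decide) hctx₂.one ?_)
  have hctx₃ := hctx₂.setReg rU (s₂.reg rFals)
  refine .step (.copy (by decide) hctx₃.one ?_)
  have hctx₄ := hctx₃.setReg rPtr ((s₂.setReg rU (s₂.reg rFals)).reg rStart)
  refine Runs.seq_frame (T' := 3) (runs_checkClause (.inr rfl) hctx₄.one hctx₄.word hc
    (hk _ (List.getElem_mem hc)) (by simpa using hstart₂) (by omega)) (by omega) ?_
  rintro s₅ ⟨hptr₅, hu'⟩ hf₅
  have hu₅ : s₅.reg rFals = falsifiedSnd H cs b c := by
    rw [hu', falsifiedSnd, hget, State.mem_setReg, State.mem_setReg, hf₂.mem _ (by decide),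
      State.mem_setReg, htab₂']
  have hU₅ : s₅.reg rU = falsifiedFst H cs a c := by
    rw [hf₅.reg _ (by decide), ← hu₂]; simp
  have hok₅ : s₅.reg rOk = s₁.reg rOk := by
    rw [hf₅.reg _ (by decide), ← hok₂]; simp
  have hle₁ : falsifiedFst H cs a c ≤ 1 := falsified_le _ _
  have hle₂ : falsifiedSnd H cs b c ≤ 1 := falsified_le _ _
  have hle := Nat.mul_le_mul hle₁ hle₂
  rw [hok] at hok₅
  have hsucc : (∀ i < c + 1, falsifiedFst H cs a i * falsifiedSnd H cs b i = 0) ↔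
      (∀ i < c, falsifiedFst H cs a i * falsifiedSnd H cs b i = 0) ∧
        falsifiedFst H cs a c * falsifiedSnd H cs b c = 0 := Nat.forall_lt_succ_right
  simp only [hsucc]
  simp only [rFals, rU, rOk, rPtr] at hu₅ hU₅ hok₅ hptr₅
  refine .step (.mul (by decide) (by decide) (by simp only [rU, rFals, hU₅, hu₅]; omega) ?_)
  refine .ite (by decide) (fun h => .const (by omega) ?_) (fun h => .skip ?_)
  · refine ⟨by simp [hptr₅], ?_⟩
    simp only [State.reg_setReg, rU, rFals, hU₅, hu₅, if_true] at h
    rw [if_neg (fun h' => h h'.2)]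
    simp
  · refine ⟨by simp [hptr₅], ?_⟩
    simp only [State.reg_setReg, rU, rFals, hU₅, hu₅, if_true] at h
    simp [hok₅, h]

/-- Set the answer to `1` if the half assignment in register `rSrc` extends to a satisfying
assignment, otherwise to `0`. -/
def tryAll : Prog :=
  expand 1 rSrc rZero ;;
  .const rAns 0 ;;
  forLoop rV rKV rA (
    expand 2 rV rH ;;
    checkAll ;;
    .ite rOk (.const rAns 1) .skip)

theorem runs_tryAll {W N H A k a : ℕ} {cs : List (List ℕ)} {s : State}
    (hctx : Ctx N H A cs s) (he₁ : EmptyOutside 1 0 H s) (he₂ : EmptyOutside 2 H H s)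
    (ha : s.reg rSrc = a) (haW : a ≤ W)
    (hk : ∀ C ∈ cs, C.length ≤ k) (hW : maxNumber N H A 0 cs ≤ W) :
    Runs W tryAll s (A * (H * 13 + cs.length * (16 * k + 21) + 14) + H * 13 + 8)
      fun s' => s'.reg rAns = if ∃ b < A, ∀ c < cs.length,
        falsifiedFst H cs a c * falsifiedSnd H cs b c = 0 then 1 else 0 := by
  have hW' := maxNumber_bounds N H A 0 cs
  refine Runs.seq_frame (T' := A * (H * 13 + cs.length * (16 * k + 21) + 14) + 4)
    (runs_expand (.inr rfl) (.inl rfl) hctx.one hctx.two hctx.h hctx.zero (by omega)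
      (by rw [ha]; exact haW) he₁) (by omega) ?_
  intro s₁ htab₁ hf₁
  rw [ha] at htab₁
  have hctx₁ := hctx.frame hf₁
  refine .step (.const (by omega) ?_)
  have hctx₂ := hctx₁.setReg rAns 0
  refine Runs.forLoop (T := H * 13 + cs.length * (16 * k + 21) + 11) A hctx₂.a hctx₂.one
    (fun b s' => EmptyOutside 2 H H s' ∧ s'.reg rAns = if ∃ i < b, ∀ c < cs.length,
        falsifiedFst H cs a c * falsifiedSnd H cs i c = 0 then 1 else 0)
    ⟨fun l hl => ?_, by simp⟩ ?_ (fun s' h _ => h.2)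
    (fun c s' x y h => ⟨h.1, by simpa using h.2⟩) le_rfl
  · rw [State.mem_setReg, hf₁.mem 2 (by decide), he₂ l hl]
  rintro b hb s₃ ⟨he₃, hans₃⟩ hV₃ hf₃
  have hctx₃ : Ctx N H A cs s₃ := hctx₂.frame hf₃
  refine Runs.seq_frame (T' := cs.length * (16 * k + 21) + 7)
    (runs_expand (.inl rfl) (.inr rfl) hctx₃.one hctx₃.two hctx₃.h hctx₃.h (by omega)
      (by rw [hV₃]; omega) he₃) (by omega) ?_
  intro s₄ htab₄ hf₄
  rw [hV₃] at htab₄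
  have htab₁₄ : s₄.mem 1 = litTable 0 H a := by
    rw [hf₄.mem 1 (by decide), hf₃.mem 1 (by decide), State.mem_setReg, htab₁]
  have hctx₄ := hctx₃.frame hf₄
  refine Runs.seq_frame (T' := 2) (runs_checkAll hctx₄ htab₁₄ htab₄ hk hW) (by omega) ?_
  intro s₅ hok hf₅
  have hans₅ : s₅.reg rAns = s₃.reg rAns :=
    (hf₅.reg _ (by decide)).trans (hf₄.reg _ (by decide))
  have he₅ : EmptyOutside 2 H H s₅ := .of_eq ((hf₅.mem 2 (by decide)).trans htab₄)
  have hsucc : (∃ i < b + 1, ∀ c < cs.length,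
        falsifiedFst H cs a c * falsifiedSnd H cs i c = 0) ↔
      (∃ i < b, ∀ c < cs.length, falsifiedFst H cs a c * falsifiedSnd H cs i c = 0) ∨
        ∀ c < cs.length, falsifiedFst H cs a c * falsifiedSnd H cs b c = 0 :=
    Nat.exists_lt_succ_right
  rw [hans₃] at hans₅
  simp only [hsucc]
  refine .ite (by decide) (fun h => .const (by omega) ?_) (fun h => .skip ?_)
  · rw [hok, ne_eq, ite_eq_right_iff, not_forall] at h
    obtain ⟨h, -⟩ := h
    refine ⟨he₅, ?_⟩
    rw [if_pos (.inr h)]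
    simp
  · rw [hok, ite_eq_right_iff] at h
    refine ⟨he₅, hans₅.trans ?_⟩
    have h' : ¬ ∀ c < cs.length, falsifiedFst H cs a c * falsifiedSnd H cs b c = 0 :=
      fun h' => one_ne_zero (h h')
    simp only [h', or_false]
end RAM

/-! ### Walks, reachability and gradings -/

namespace Digraph

variable {V : Type*}

theorem reaches_iff_reflTransGen {G : Digraph V} {v w : V} :
    G.Reaches v w ↔ Relation.ReflTransGen G.Adj v w := by
  constructor
  · rintro ⟨k, hk⟩
    induction k generalizing v with
    | zero => exact hk ▸ .refl
    | succ k ih =>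
      obtain ⟨u, hu, hk⟩ := hk
      exact .head hu (ih hk)
  · intro h
    induction h using Relation.ReflTransGen.head_induction_on with
    | refl => exact ⟨0, rfl⟩
    | head hu _ ih =>
      obtain ⟨k, hk⟩ := ih
      exact ⟨k + 1, _, hu, hk⟩

theorem Reaches.mem_of_closed {G : Digraph V} {v w : V} (h : G.Reaches v w) {S : Set V}
    (hv : v ∈ S) (hS : ∀ x y, G.Adj x y → x ∈ S → y ∈ S) : w ∈ S := by
  rw [reaches_iff_reflTransGen] at h
  induction h with
  | refl => exact hv
  | tail _ hxy ih => exact hS _ _ hxy ih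

theorem HasWalk.grading {G : Digraph V} {f : V → ℕ} (hf : ∀ v w, G.Adj v w → f w = f v + 1)
    {k : ℕ} {v w : V} (h : G.HasWalk k v w) : f w = f v + k := by
  induction k generalizing v with
  | zero => rw [show v = w from h]; rfl
  | succ k ih =>
    obtain ⟨u, hu, hk⟩ := h
    rw [ih hk, hf v u hu]
    omega

theorem Reaches.hasWalk_dist {G : Digraph V} {v w : V} (h : G.Reaches v w) :
    G.HasWalk (G.dist v w) v w :=
  Nat.sInf_mem (s := {k | G.HasWalk k v w}) h

/-- If every edge raises `f` by one, then the distance is the difference of the values of `f`. -/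
theorem Reaches.dist_grading {G : Digraph V} {f : V → ℕ} (hf : ∀ v w, G.Adj v w → f w = f v + 1)
    {v w : V} (h : G.Reaches v w) : f w = f v + G.dist v w :=
  h.hasWalk_dist.grading hf

theorem mem_reachSet [Fintype V] {G : Digraph V} {v w : V} : w ∈ G.reachSet v ↔ G.Reaches v w := by
  simp [reachSet]

theorem self_mem_reachSet [Fintype V] (G : Digraph V) (v : V) : v ∈ G.reachSet v :=
  mem_reachSet.2 ⟨0, rfl⟩

/-- A vertex that reaches at most `B` others has Lin's index at most `B / (n - 1)`, since the other
vertices have distance at least one. -/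
theorem closeness_le [Fintype V] (G : Digraph V) (v : V) {B : ℕ}
    (hB : (G.reachSet v).card ≤ B + 1) :
    G.closeness v ≤ (B : ℚ) / ((Fintype.card V : ℚ) - 1) := by
  classical
  have hpos : 0 < Fintype.card V := Fintype.card_pos_iff.2 ⟨v⟩
  have hn : (0 : ℚ) ≤ (Fintype.card V : ℚ) - 1 := by
    have : (1 : ℚ) ≤ Fintype.card V := by exact_mod_cast hpos
    linarith
  have hr : (0 : ℚ) ≤ ((G.reachSet v).card : ℚ) - 1 := by
    have : (1 : ℚ) ≤ (G.reachSet v).card := by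
      exact_mod_cast Finset.card_pos.2 ⟨v, G.self_mem_reachSet v⟩
    linarith
  have hrB : ((G.reachSet v).card : ℚ) - 1 ≤ B := by
    have : ((G.reachSet v).card : ℚ) ≤ B + 1 := by exact_mod_cast hB
    linarith
  have hsum : ((G.reachSet v).card : ℚ) - 1 ≤ ∑ w ∈ G.reachSet v, (G.dist v w : ℚ) := by
    rw [← Finset.add_sum_erase _ _ (G.self_mem_reachSet v),
      ← Finset.card_erase_add_one (G.self_mem_reachSet v)]
    have : ((((G.reachSet v).erase v).card : ℕ) : ℚ) ≤
        ∑ w ∈ (G.reachSet v).erase v, (G.dist v w : ℚ) := by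
      rw [Finset.card_eq_sum_ones, Nat.cast_sum]
      refine Finset.sum_le_sum fun w hw => ?_
      rw [Finset.mem_erase, mem_reachSet] at hw
      have : G.dist v w ≠ 0 := fun h => hw.1 (by
        have := hw.2.hasWalk_dist
        rw [h] at this
        exact (show v = w from this).symm)
      exact_mod_cast Nat.one_le_iff_ne_zero.2 this
    push_cast
    linarith [(Nat.cast_nonneg (G.dist v v) : (0 : ℚ) ≤ _)]
  rw [closeness]
  set r : ℚ := ((G.reachSet v).card : ℚ) - 1
  set d : ℚ := ∑ w ∈ G.reachSet v, (G.dist v w : ℚ)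
  rcases hn.eq_or_lt with h0 | h0
  · rw [← h0]; simp
  rcases hr.eq_or_lt with h1 | h1
  · rw [← h1]; simp; positivity
  rw [div_le_div_iff₀ (mul_pos h0 (h1.trans_le hsum)) h0]
  have := mul_le_mul_of_nonneg_left (mul_le_mul hrB hsum hr (hr.trans hrB)) h0.le
  nlinarith

end Digraph

/-! ### The centralities in the graph -/

theorem mem_graphEdges {A M : ℕ} {u v : ℕ → ℕ → ℕ} {x y : ℕ} :
    (x, y) ∈ graphEdges A M u v ↔
      (x < A ∧ 2 * A ≤ y ∧ y < 2 * A + 3) ∨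
      (x < A ∧ ∃ c < M, y = chainBase A + 2 * c + u x c) ∨
      (∃ b < A, ∃ c < M, v b c ≠ 0 ∧ x = chainBase A + 6 * M + 2 * c + 1 ∧ y = A + b) ∨
      (∃ q < 3, ∃ i < 12 * A, i / (4 * A) = q ∧ x = 2 * A + q ∧ y = 2 * A + 3 + i) ∨
      ∃ i < 6 * M, x = chainBase A + i ∧ y = chainBase A + i + M + M := by
  have h₁ : (x, y) ∈ (List.range A).flatMap (edgesFrom A M u) ↔
      (x < A ∧ 2 * A ≤ y ∧ y < 2 * A + 3) ∨
      (x < A ∧ ∃ c < M, y = chainBase A + 2 * c + u x c) := by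
    simp only [List.mem_flatMap, List.mem_range, edgesFrom, List.mem_append, List.mem_cons,
      List.mem_map, List.not_mem_nil, Prod.mk.injEq, or_false]
    constructor
    · rintro ⟨a, ha, (⟨rfl, rfl⟩ | ⟨rfl, rfl⟩ | ⟨rfl, rfl⟩) | ⟨c, hc, rfl, rfl⟩⟩
      · left; omega
      · left; omega
      · left; omega
      · exact .inr ⟨ha, c, hc, rfl⟩
    · rintro (⟨hx, hy₁, hy₂⟩ | ⟨hx, c, hc, rfl⟩)
      · exact ⟨x, hx, .inl (by omega)⟩
      · exact ⟨x, hx, .inr ⟨c, hc, rfl, rfl⟩⟩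
  have h₂ : (x, y) ∈ (List.range A).flatMap (fun b => (List.range M).flatMap (edgeTo A M v b)) ↔
      ∃ b < A, ∃ c < M, v b c ≠ 0 ∧ x = chainBase A + 6 * M + 2 * c + 1 ∧ y = A + b := by
    simp only [List.mem_flatMap, List.mem_range, edgeTo]
    refine exists_congr fun b => and_congr_right fun _ => exists_congr fun c =>
      and_congr_right fun _ => ?_
    split_ifs with h <;> simp [h]
  have h₃ : (∃ i < 12 * A, x = 2 * A + i / (4 * A) ∧ y = 2 * A + 3 + i) ↔
      ∃ q < 3, ∃ i < 12 * A, i / (4 * A) = q ∧ x = 2 * A + q ∧ y = 2 * A + 3 + i := by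
    constructor
    · rintro ⟨i, hi, hx, hy⟩
      exact ⟨_, by rw [Nat.div_lt_iff_lt_mul (by omega)]; omega, i, hi, rfl, hx, hy⟩
    · rintro ⟨_, -, i, hi, rfl, hx, hy⟩
      exact ⟨i, hi, hx, hy⟩
  rw [← h₃]
  simp only [graphEdges, List.mem_append, h₁, h₂, List.mem_map, List.mem_range, Prod.mk.injEq,
    or_assoc, @eq_comm _ x, @eq_comm _ y]

/-- The layer of a vertex; every edge goes from a layer to the next one. -/
def layer (A M x : ℕ) : ℕ :=
  if x < A then 0 else if x < 2 * A then 5 else if x < 2 * A + 3 then 1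
  else if x < chainBase A then 2 else 1 + (x - chainBase A) / (2 * M)

theorem layer_eq_of_mem_graphEdges {A M : ℕ} {u v : ℕ → ℕ → ℕ} {x y : ℕ} (hu : ∀ a c, u a c ≤ 1)
    (h : (x, y) ∈ graphEdges A M u v) : layer A M y = layer A M x + 1 := by
  have hX : chainBase A = 14 * A + 3 := rfl
  rw [mem_graphEdges] at h
  rcases h with ⟨hx, h₁, h₂⟩ | ⟨hx, c, hc, rfl⟩ | ⟨b, hb, c, hc, -, rfl, rfl⟩ |
    ⟨q, hq, i, hi, -, rfl, rfl⟩ | ⟨i, hi, rfl, rfl⟩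
  · simp [layer, hx, h₂, show ¬ y < A by omega, show ¬ y < 2 * A by omega]
  · have := hu x c
    have hd : (chainBase A + 2 * c + u x c - chainBase A) / (2 * M) = 0 :=
      Nat.div_eq_of_lt (by omega)
    unfold layer
    rw [hd, if_pos hx, if_neg (by omega), if_neg (by omega), if_neg (by omega), if_neg (by omega)]
  · have hd : (chainBase A + 6 * M + 2 * c + 1 - chainBase A) / (2 * M) = 3 := by
      rw [Nat.div_eq_iff (by omega)]; omega
    unfold layer
    rw [hd, if_neg (by omega), if_pos (by omega), if_neg (by omega), if_neg (by omega),
      if_neg (by omega), if_neg (by omega)]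
  · unfold layer
    rw [if_neg (by omega), if_neg (by omega), if_neg (by omega), if_pos (by omega),
      if_neg (by omega), if_neg (by omega), if_pos (by omega)]
  · have hd : (chainBase A + i + M + M - chainBase A) / (2 * M) =
        (chainBase A + i - chainBase A) / (2 * M) + 1 := by
      rw [show chainBase A + i + M + M - chainBase A = i + 2 * M by omega,
        Nat.add_div_right _ (by omega), Nat.add_sub_cancel_left]
    unfold layer
    rw [hd, if_neg (by omega), if_neg (by omega), if_neg (by omega), if_neg (by omega),
      if_neg (by omega), if_neg (by omega), if_neg (by omega), if_neg (by omega)]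
    omega

open Classical in
/-- The second half assignments that falsify some clause together with the first half assignment
`a`. -/
noncomputable def conflicts (A M : ℕ) (u v : ℕ → ℕ → ℕ) (a : ℕ) : Finset ℕ :=
  (Finset.range A).filter fun b => ∃ c < M, u a c ≠ 0 ∧ v b c ≠ 0

/-- What the half assignment `a` reaches in the chains. -/
def chainPart (A M : ℕ) (u : ℕ → ℕ → ℕ) (a : ℕ) : Finset ℕ :=
  (Finset.range 4 ×ˢ Finset.range M).image
    fun p => chainBase A + 2 * (M * p.1) + 2 * p.2 + u a p.2

/-- What the half assignment `a` reaches. -/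
noncomputable def reachNat (A M : ℕ) (u v : ℕ → ℕ → ℕ) (a : ℕ) : Finset ℕ :=
  ({a} ∪ Finset.Ico (2 * A) (2 * A + 3) ∪ Finset.Ico (2 * A + 3) (chainBase A)) ∪
    (chainPart A M u a ∪ (conflicts A M u v a).map (addLeftEmbedding A))

theorem sum_reachNat {A M : ℕ} {u v : ℕ → ℕ → ℕ} (hu : ∀ a c, u a c ≤ 1) {a : ℕ} (ha : a < A)
    (f : ℕ → ℕ) :
    ∑ x ∈ reachNat A M u v a, f x = f a + ∑ x ∈ Finset.Ico (2 * A) (2 * A + 3), f x +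
      ∑ x ∈ Finset.Ico (2 * A + 3) (chainBase A), f x +
      (∑ i ∈ Finset.range 4, ∑ c ∈ Finset.range M,
        f (chainBase A + 2 * (M * i) + 2 * c + u a c) +
      ∑ b ∈ conflicts A M u v a, f (A + b)) := by
  have hX : chainBase A = 14 * A + 3 := rfl
  have hchain : ∀ x ∈ chainPart A M u a, chainBase A ≤ x := by
    intro x hx
    simp only [chainPart, Finset.mem_image] at hx
    obtain ⟨p, -, rfl⟩ := hx
    omega
  have hb : ∀ x ∈ (conflicts A M u v a).map (addLeftEmbedding A), A ≤ x ∧ x < 2 * A := by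
    intro x hx
    simp only [conflicts, Finset.mem_map, Finset.mem_filter, Finset.mem_range] at hx
    obtain ⟨b, ⟨hb, -⟩, rfl⟩ := hx
    simp only [addLeftEmbedding_apply]
    omega
  rw [reachNat, Finset.sum_union, Finset.sum_union, Finset.sum_union, Finset.sum_union,
    Finset.sum_singleton, Finset.sum_map, chainPart, Finset.sum_image, Finset.sum_product]
  · rfl
  · rintro ⟨i, c⟩ hp ⟨j, d⟩ hq h
    simp only [Finset.coe_product, Finset.coe_range, Set.mem_prod, Set.mem_Iio] at hp hq
    obtain ⟨hi, hc⟩ := hp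
    obtain ⟨hj, hd⟩ := hq
    have := hu a c
    have := hu a d
    simp only at h
    have hij : i = j := by
      interval_cases i <;> interval_cases j <;> omega
    subst hij
    simp only [Prod.mk.injEq, true_and]
    omega
  · rw [Finset.disjoint_left]
    intro x hx hx'
    have := hchain x hx
    have := hb x hx'
    omega
  · rw [Finset.disjoint_left]
    intro x hx hx'
    rw [Finset.mem_singleton] at hx
    rw [Finset.mem_Ico] at hx'
    omega
  · rw [Finset.disjoint_left]
    intro x hx hx'
    rw [Finset.mem_union, Finset.mem_singleton, Finset.mem_Ico] at hx
    rw [Finset.mem_Ico] at hx'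
    omega
  · rw [Finset.disjoint_left]
    intro x hx hx'
    rw [Finset.mem_union, Finset.mem_union, Finset.mem_singleton, Finset.mem_Ico,
      Finset.mem_Ico] at hx
    rw [Finset.mem_union] at hx'
    rcases hx' with hx' | hx'
    · have := hchain x hx'
      omega
    · have := hb x hx'
      omega

theorem card_reachNat {A M : ℕ} {u v : ℕ → ℕ → ℕ} (hu : ∀ a c, u a c ≤ 1) {a : ℕ} (ha : a < A) :
    (reachNat A M u v a).card = 1 + (3 + 12 * A + 4 * M + (conflicts A M u v a).card) := by
  rw [Finset.card_eq_sum_ones, sum_reachNat hu ha]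
  simp [chainBase]
  omega

theorem sum_layer_reachNat {A M : ℕ} {u v : ℕ → ℕ → ℕ} (hu : ∀ a c, u a c ≤ 1) {a : ℕ}
    (ha : a < A) :
    ∑ x ∈ reachNat A M u v a, layer A M x =
      3 + 24 * A + 10 * M + 5 * (conflicts A M u v a).card := by
  have hX : chainBase A = 14 * A + 3 := rfl
  have h₁ : ∀ x ∈ Finset.Ico (2 * A) (2 * A + 3), layer A M x = 1 := by
    intro x hx
    rw [Finset.mem_Ico] at hx
    rw [layer, if_neg (by omega), if_neg (by omega), if_pos (by omega)]
  have h₂ : ∀ x ∈ Finset.Ico (2 * A + 3) (chainBase A), layer A M x = 2 := by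
    intro x hx
    rw [Finset.mem_Ico] at hx
    rw [layer, if_neg (by omega), if_neg (by omega), if_neg (by omega), if_pos (by omega)]
  have h₃ : ∀ i, ∀ c ∈ Finset.range M,
      layer A M (chainBase A + 2 * (M * i) + 2 * c + u a c) = 1 + i := by
    intro i c hc
    rw [Finset.mem_range] at hc
    have := hu a c
    rw [layer, if_neg (by omega), if_neg (by omega), if_neg (by omega), if_neg (by omega),
      show chainBase A + 2 * (M * i) + 2 * c + u a c - chainBase A = 2 * c + u a c + 2 * M * i by
        rw [mul_assoc]; omega,
      Nat.add_mul_div_left _ _ (by omega), Nat.div_eq_of_lt (by omega), zero_add]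
  have h₄ : ∀ b ∈ conflicts A M u v a, layer A M (A + b) = 5 := by
    intro b hb
    simp only [conflicts, Finset.mem_filter, Finset.mem_range] at hb
    rw [layer, if_neg (by omega), if_pos (by omega)]
  rw [sum_reachNat hu ha, Finset.sum_congr rfl h₁, Finset.sum_congr rfl h₂,
    Finset.sum_congr rfl fun i _ => Finset.sum_congr rfl (h₃ i), Finset.sum_congr rfl h₄, layer,
    if_pos ha]
  simp [chainBase, Finset.sum_range_succ]
  omega

section
variable {n A M : ℕ} {u v : ℕ → ℕ → ℕ} {G : Digraph (Fin n)}

theorem map_reachSet_eq (hu : ∀ a c, u a c ≤ 1) (hn : chainBase A + 8 * M ≤ n)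
    (hG : ∀ x y : Fin n, G.Adj x y ↔ ((x : ℕ), (y : ℕ)) ∈ graphEdges A M u v)
    (a : Fin n) (ha : (a : ℕ) < A) :
    (G.reachSet a).map Fin.valEmbedding = reachNat A M u v a := by
  have hX : chainBase A = 14 * A + 3 := rfl
  have hmem : ∀ x, x ∈ reachNat A M u v a ↔ x = a ∨ (2 * A ≤ x ∧ x < chainBase A) ∨
      (∃ i < 4, ∃ c < M, x = chainBase A + 2 * (M * i) + 2 * c + u a c) ∨
      ∃ b < A, x = A + b ∧ ∃ c < M, u a c ≠ 0 ∧ v b c ≠ 0 := by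
    intro x
    simp only [reachNat, chainPart, conflicts, Finset.mem_union, Finset.mem_singleton,
      Finset.mem_Ico, Finset.mem_image, Finset.mem_product, Finset.mem_range, Prod.exists,
      Finset.mem_map, Finset.mem_filter, addLeftEmbedding_apply]
    constructor
    · rintro (((h | h) | h) | ⟨i, c, ⟨hi, hc⟩, rfl⟩ | ⟨b, ⟨hb, hc⟩, rfl⟩)
      · exact .inl h
      · exact .inr (.inl (by omega))
      · exact .inr (.inl (by omega))
      · exact .inr (.inr (.inl ⟨i, hi, c, hc, rfl⟩))
      · exact .inr (.inr (.inr ⟨b, hb, rfl, hc⟩))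
    · rintro (h | h | ⟨i, hi, c, hc, rfl⟩ | ⟨b, hb, rfl, hc⟩)
      · exact .inl (.inl (.inl h))
      · by_cases h' : x < 2 * A + 3
        · exact .inl (.inl (.inr ⟨h.1, h'⟩))
        · exact .inl (.inr ⟨not_lt.1 h', h.2⟩)
      · exact .inr (.inl ⟨i, c, ⟨hi, hc⟩, rfl⟩)
      · exact .inr (.inr ⟨b, ⟨hb, hc⟩, rfl⟩)
  ext x
  simp only [Finset.mem_map, Digraph.mem_reachSet, Fin.valEmbedding_apply]
  constructor
  · rintro ⟨w, hw, rfl⟩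
    refine hw.mem_of_closed (S := {w | (w : ℕ) ∈ reachNat A M u v a}) ((hmem _).2 (.inl rfl)) ?_
    intro x y hxy hx
    change (_ : ℕ) ∈ reachNat A M u v a at hx ⊢
    rw [hmem] at hx ⊢
    rw [hG, mem_graphEdges] at hxy
    generalize (y : ℕ) = y at *
    rcases hx with hx | hx | ⟨i, hi, c, hc, hx⟩ | ⟨b, hb, hx, -⟩
    · rw [hx] at hxy
      rcases hxy with h | ⟨-, c, hc, rfl⟩ | ⟨b, hb, c, hc, -, h, -⟩ | ⟨q, hq, i, hi, -, h, -⟩ |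
        ⟨i, hi, h, -⟩
      · exact .inr (.inl (by omega))
      · exact .inr (.inr (.inl ⟨0, by omega, c, hc, by omega⟩))
      all_goals omega
    · generalize (x : ℕ) = x at *
      rcases hxy with h | ⟨h, -⟩ | ⟨b, hb, c, hc, -, h, -⟩ | ⟨q, hq, i, hi, -, -, rfl⟩ |
        ⟨i, hi, h, -⟩
      · omega
      · omega
      · omega
      · exact .inr (.inl (by omega))
      · omega
    · have hle := hu a c
      generalize (x : ℕ) = x at *
      rcases hxy with h | ⟨h, -⟩ | ⟨b, hb, c', hc', hv, h, rfl⟩ | ⟨q, hq, j, hj, -, h, -⟩ |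
        ⟨j, hj, h, rfl⟩
      · omega
      · omega
      · have hcc : c' = c ∧ u a c ≠ 0 := by
          interval_cases i <;> omega
        exact .inr (.inr (.inr ⟨b, hb, rfl, c, hc, hcc.2, hcc.1 ▸ hv⟩))
      · omega
      · refine .inr (.inr (.inl ⟨i + 1, ?_, c, hc, ?_⟩))
        · interval_cases i <;> omega
        · rw [Nat.mul_add]; omega
    · generalize (x : ℕ) = x at *
      rcases hxy with h | ⟨h, -⟩ | ⟨b', hb', c, hc, -, h, -⟩ | ⟨q, hq, i, hi, -, h, -⟩ |
        ⟨i, hi, h, -⟩ <;>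
        omega
  · have step : ∀ {y z : ℕ}, (∃ w, G.Reaches a w ∧ (w : ℕ) = y) → (y, z) ∈ graphEdges A M u v →
        z < n → ∃ w, G.Reaches a w ∧ (w : ℕ) = z := by
      rintro y z ⟨w, hw, rfl⟩ hyz hz
      refine ⟨⟨z, hz⟩, ?_, rfl⟩
      rw [Digraph.reaches_iff_reflTransGen] at hw ⊢
      exact hw.tail ((hG _ _).2 hyz)
    have hself : ∃ w, G.Reaches a w ∧ (w : ℕ) = a := ⟨a, ⟨0, rfl⟩, rfl⟩
    have hhub : ∀ y, 2 * A ≤ y → y < 2 * A + 3 → ∃ w, G.Reaches a w ∧ (w : ℕ) = y :=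
      fun y h₁ h₂ => step hself (mem_graphEdges.2 (.inl ⟨ha, h₁, h₂⟩)) (by omega)
    have hchain : ∀ i < 4, ∀ c < M, ∃ w, G.Reaches a w ∧
        (w : ℕ) = chainBase A + 2 * (M * i) + 2 * c + u a c := by
      intro i
      induction i with
      | zero =>
        intro _ c hc
        have := hu a c
        exact step hself (mem_graphEdges.2 (.inr (.inl ⟨ha, c, hc, by omega⟩))) (by omega)
      | succ i ih =>
        intro hi c hc
        have := hu a c
        have hMi : M * i ≤ M * 2 := Nat.mul_le_mul_left _ (by omega)
        refine step (ih (by omega) c hc) (mem_graphEdges.2 (.inr (.inr (.inr (.inr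
          ⟨2 * (M * i) + 2 * c + u a c, by omega, by omega, ?_⟩))))) ?_
        · rw [Nat.mul_add]; omega
        · rw [Nat.mul_add]; omega
    rw [hmem]
    rintro (rfl | ⟨h₁, h₂⟩ | ⟨i, hi, c, hc, rfl⟩ | ⟨b, hb, rfl, c, hc, h₁, h₂⟩)
    · exact hself
    · by_cases h : x < 2 * A + 3
      · exact hhub x h₁ h
      · have hd : (x - (2 * A + 3)) / (4 * A) < 3 := by
          rw [Nat.div_lt_iff_lt_mul (by omega)]; omega
        generalize hq : (x - (2 * A + 3)) / (4 * A) = q at hd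
        exact step (hhub (2 * A + q) (by omega) (by omega))
          (mem_graphEdges.2 (.inr (.inr (.inr (.inl
            ⟨q, hd, x - (2 * A + 3), by omega, hq, rfl, by omega⟩))))) (by omega)
    · exact hchain i hi c hc
    · have := hu a c
      exact step (hchain 3 (by omega) c hc) (mem_graphEdges.2 (.inr (.inr (.inl
        ⟨b, hb, c, hc, h₂, by omega, rfl⟩)))) (by omega)

/-- The index of a first half assignment depends only on the number of its conflicts. -/
theorem closeness_eq (hu : ∀ a c, u a c ≤ 1) (hn : chainBase A + 8 * M ≤ n)
    (hG : ∀ x y : Fin n, G.Adj x y ↔ ((x : ℕ), (y : ℕ)) ∈ graphEdges A M u v)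
    (a : Fin n) (ha : (a : ℕ) < A) :
    G.closeness a = (3 + 12 * A + 4 * M + (conflicts A M u v a).card : ℚ) ^ 2 /
      (((n : ℚ) - 1) * (3 + 24 * A + 10 * M + 5 * (conflicts A M u v a).card)) := by
  have hmap := map_reachSet_eq hu hn hG a ha
  have hcard : (G.reachSet a).card = 1 + (3 + 12 * A + 4 * M + (conflicts A M u v a).card) := by
    rw [← card_reachNat hu ha, ← hmap, Finset.card_map]
  have hsum : ∑ w ∈ G.reachSet a, G.dist a w =
      3 + 24 * A + 10 * M + 5 * (conflicts A M u v a).card := by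
    rw [← sum_layer_reachNat hu ha, ← hmap, Finset.sum_map]
    refine Finset.sum_congr rfl fun w hw => ?_
    have := (Digraph.mem_reachSet.1 hw).dist_grading (f := fun w : Fin n => layer A M w)
      fun x y h => layer_eq_of_mem_graphEdges hu ((hG x y).1 h)
    simp only [layer, if_pos ha, zero_add] at this
    simp only [Fin.valEmbedding_apply, layer]
    exact this.symm
  rw [Digraph.closeness, hcard, ← Nat.cast_sum, hsum, Fintype.card_fin]
  push_cast
  congr 2
  ring

/-- A vertex that is not a first half assignment reaches at most `4 * A` others: the dummies of one
hub, or the rest of a chain and second half assignments, or nothing. -/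
theorem closeness_le_of_le (hA : 0 < A)
    (hG : ∀ x y : Fin n, G.Adj x y ↔ ((x : ℕ), (y : ℕ)) ∈ graphEdges A M u v)
    (x : Fin n) (hx : A ≤ (x : ℕ)) :
    G.closeness x ≤ ((4 * A : ℕ) : ℚ) / ((n : ℚ) - 1) := by
  have hX : chainBase A = 14 * A + 3 := rfl
  suffices H : ∃ S : Finset ℕ, S.card ≤ 4 * A + 1 ∧ (x : ℕ) ∈ S ∧
      ∀ y z, (y, z) ∈ graphEdges A M u v → y ∈ S → z ∈ S by
    obtain ⟨S, hS, hxS, hcl⟩ := H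
    have hle : (G.reachSet x).card ≤ S.card := by
      rw [← Finset.card_map Fin.valEmbedding]
      refine Finset.card_le_card fun y hy => ?_
      simp only [Finset.mem_map, Digraph.mem_reachSet, Fin.valEmbedding_apply] at hy
      obtain ⟨w, hw, rfl⟩ := hy
      exact hw.mem_of_closed (S := {w | (w : ℕ) ∈ S}) hxS fun y z h => hcl y z ((hG y z).1 h)
    have := G.closeness_le x (hle.trans hS)
    rwa [Fintype.card_fin] at this
  generalize (x : ℕ) = x at *
  by_cases h₁ : 2 * A ≤ x ∧ x < 2 * A + 3
  · refine ⟨insert x (Finset.Ico (2 * A + 3 + (x - 2 * A) * (4 * A))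
      (2 * A + 3 + (x - 2 * A) * (4 * A) + 4 * A)), ?_, Finset.mem_insert_self _ _, ?_⟩
    · refine (Finset.card_insert_le _ _).trans ?_
      rw [Nat.card_Ico]; omega
    · intro y z hyz hy
      simp only [Finset.mem_insert, Finset.mem_Ico] at hy ⊢
      rw [mem_graphEdges] at hyz
      rcases hyz with h | ⟨h, -⟩ | ⟨b, hb, c, hc, -, h, -⟩ | ⟨q, hq, i, hi, hd, h, rfl⟩ |
        ⟨i, hi, h, -⟩
      · omega
      · omega
      · have := Nat.mul_le_mul_right (4 * A) (show x - 2 * A ≤ 2 by omega); omega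
      · obtain rfl : q = x - 2 * A := by omega
        rw [Nat.div_eq_iff (by omega)] at hd
        omega
      · have := Nat.mul_le_mul_right (4 * A) (show x - 2 * A ≤ 2 by omega); omega
  by_cases h₂ : x < chainBase A
  · refine ⟨{x}, by simp, by simp, fun y z hyz hy => ?_⟩
    rw [Finset.mem_singleton] at hy
    subst hy
    rw [mem_graphEdges] at hyz
    rcases hyz with h | ⟨h, -⟩ | ⟨b, hb, c, hc, -, h, -⟩ | ⟨q, hq, i, hi, -, h, -⟩ | ⟨i, hi, h, -⟩
    · omega
    · omega
    · omega
    · omega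
    · omega
  · refine ⟨{x, x + 2 * M, x + 4 * M, x + 6 * M} ∪ Finset.Ico A (2 * A), ?_, by simp, ?_⟩
    · refine (Finset.card_union_le _ _).trans ?_
      have := Finset.card_le_four (a := x) (b := x + 2 * M) (c := x + 4 * M) (d := x + 6 * M)
      rw [Nat.card_Ico]; omega
    · intro y z hyz hy
      simp only [Finset.mem_union, Finset.mem_insert, Finset.mem_singleton, Finset.mem_Ico] at hy ⊢
      rw [mem_graphEdges] at hyz
      rcases hyz with h | ⟨h, -⟩ | ⟨b, hb, c, hc, -, h, rfl⟩ | ⟨q, hq, i, hi, -, h, -⟩ |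
        ⟨i, hi, h, rfl⟩
      · omega
      · omega
      · omega
      · omega
      · omega

/-- If some pair of half assignments has no common falsified clause, then every most central vertex
is a first half assignment of such a pair: it misses a second half assignment, which lies at more
than twice the average distance. -/
theorem exists_of_isMostCentral (hu : ∀ a c, u a c ≤ 1) (hn : chainBase A + 8 * M ≤ n)
    (hG : ∀ x y : Fin n, G.Adj x y ↔ ((x : ℕ), (y : ℕ)) ∈ graphEdges A M u v)
    (hsat : ∃ a < A, ∃ b < A, ∀ c < M, u a c * v b c = 0)
    {x : Fin n} (hx : G.IsMostCentral x) :
    (x : ℕ) < A ∧ ∃ b < A, ∀ c < M, u x c * v b c = 0 := by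
  classical
  obtain ⟨a, ha, b, hb, hab⟩ := hsat
  have hX : chainBase A = 14 * A + 3 := rfl
  have hA : 0 < A := by omega
  have hn1 : (0 : ℚ) < (n : ℚ) - 1 := by
    have : (1 : ℚ) < n := by exact_mod_cast (by omega : 1 < n)
    linarith
  have hle : ∀ a, (conflicts A M u v a).card ≤ A := fun a =>
    (Finset.card_filter_le _ _).trans (Finset.card_range A).le
  have hlt : (conflicts A M u v a).card < A := by
    conv_rhs => rw [← Finset.card_range A]
    refine Finset.card_lt_card (Finset.filter_ssubset.2 ⟨b, Finset.mem_range.2 hb, ?_⟩)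
    rintro ⟨c, hc, h₁, h₂⟩
    exact Nat.mul_ne_zero h₁ h₂ (hab c hc)
  have hmax := hx ⟨a, by omega⟩
  rw [closeness_eq hu hn hG ⟨a, by omega⟩ ha] at hmax
  simp only at hmax
  set k := (conflicts A M u v a).card
  have hkA : (k : ℚ) + 1 ≤ A := by exact_mod_cast hlt
  have hk0 : (0 : ℚ) ≤ k := Nat.cast_nonneg _
  have hM0 : (0 : ℚ) ≤ M := Nat.cast_nonneg _
  have hA0 : (0 : ℚ) ≤ A := Nat.cast_nonneg _
  have hAM : (0 : ℚ) ≤ A * M := mul_nonneg hA0 hM0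
  have hAk : (0 : ℚ) ≤ A * k := mul_nonneg hA0 hk0
  have hMk : (0 : ℚ) ≤ M * k := mul_nonneg hM0 hk0
  have hxA : (x : ℕ) < A := by
    by_contra h
    have h₁ := hmax.trans (closeness_le_of_le hA hG x (not_lt.1 h))
    rw [div_le_div_iff₀ (by positivity) hn1] at h₁
    have h₂ : ((n : ℚ) - 1) * (3 + 12 * A + 4 * M + k) ^ 2 ≤
        ((n : ℚ) - 1) * (4 * A * (3 + 24 * A + 10 * M + 5 * k)) := by
      push_cast at h₁; linarith
    have h₃ := le_of_mul_le_mul_left h₂ hn1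
    nlinarith
  refine ⟨hxA, ?_⟩
  by_contra hno
  have hfull : (conflicts A M u v x).card = A := by
    rw [conflicts, Finset.filter_true_of_mem, Finset.card_range]
    intro b hb
    by_contra h
    refine hno ⟨b, Finset.mem_range.1 hb, fun c hc => ?_⟩
    by_contra h'
    exact h ⟨c, hc, left_ne_zero_of_mul h', right_ne_zero_of_mul h'⟩
  rw [closeness_eq hu hn hG x hxA, hfull, div_le_div_iff₀ (by positivity) (by positivity)] at hmax
  have h₂ : ((n : ℚ) - 1) * ((3 + 12 * A + 4 * M + k) ^ 2 * (3 + 24 * A + 10 * M + 5 * A)) ≤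
      ((n : ℚ) - 1) * ((3 + 12 * A + 4 * M + A) ^ 2 * (3 + 24 * A + 10 * M + 5 * k)) := by
    linarith
  have h₃ := le_of_mul_le_mul_left h₂ hn1
  -- The two indices are compared with the difference `A - k` of the numbers of conflicts factored
  -- out.
  have h₄ : (3 + 12 * A + 4 * M + k : ℚ) ^ 2 * (3 + 24 * A + 10 * M + 5 * A) -
      (3 + 12 * A + 4 * M + A) ^ 2 * (3 + 24 * A + 10 * M + 5 * k) =
      (A - k) * (5 * (3 + 12 * A + 4 * M + k) ^ 2 -
        (6 + 25 * A + 8 * M + k) * (3 + 24 * A + 10 * M + 5 * k)) := by ring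
  have h₅ : (0 : ℚ) < 5 * (3 + 12 * A + 4 * M + k) ^ 2 -
        (6 + 25 * A + 8 * M + k) * (3 + 24 * A + 10 * M + 5 * k) := by
    have e₁ : (A : ℚ) * k ≤ A * A := mul_le_mul_of_nonneg_left (by linarith) hA0
    have e₂ : (M : ℚ) * k ≤ M * A := mul_le_mul_of_nonneg_left (by linarith) hM0
    nlinarith
  have := mul_pos (by linarith : (0 : ℚ) < A - k) h₅
  linarith

end

theorem nodup_graphEdges {A M : ℕ} {u v : ℕ → ℕ → ℕ} (hu : ∀ a c, u a c ≤ 1) :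
    (graphEdges A M u v).Nodup := by
  have hX : chainBase A = 14 * A + 3 := rfl
  have h₁ : ((List.range A).flatMap (edgesFrom A M u)).Nodup := by
    rw [List.nodup_flatMap]
    refine ⟨fun a ha => ?_, ?_⟩
    · rw [List.mem_range] at ha
      rw [edgesFrom, List.nodup_append]
      refine ⟨by simp, ?_, ?_⟩
      · refine List.Nodup.map_on ?_ List.nodup_range
        intro c _ d _ h
        have := hu a c
        have := hu a d
        simp only [Prod.mk.injEq, true_and] at h
        omega
      · rintro ⟨x, y⟩ hx ⟨z, w⟩ hz h
        simp only [List.mem_cons, List.mem_map, Prod.mk.injEq, List.not_mem_nil,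
          or_false] at hx hz h
        obtain ⟨c, -, -, hz⟩ := hz
        omega
    · refine List.nodup_range.imp ?_
      intro a b hab e h h'
      simp only [edgesFrom, List.mem_append, List.mem_cons, List.mem_map, List.not_mem_nil] at h h'
      have e₁ : e.1 = a := by
        rcases h with (rfl | rfl | rfl | h) | ⟨c, -, rfl⟩ <;> first | rfl | exact h.elim
      have e₂ : e.1 = b := by
        rcases h' with (rfl | rfl | rfl | h') | ⟨c, -, rfl⟩ <;> first | rfl | exact h'.elim
      exact hab (e₁.symm.trans e₂)
  have h₂ : ((List.range A).flatMap
      fun b => (List.range M).flatMap (edgeTo A M v b)).Nodup := by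
    rw [List.nodup_flatMap]
    refine ⟨fun b _ => ?_, ?_⟩
    · rw [List.nodup_flatMap]
      refine ⟨fun c _ => by rw [edgeTo]; split_ifs <;> simp, ?_⟩
      refine List.nodup_range.imp ?_
      intro c d hcd e h h'
      simp only [edgeTo] at h h'
      split_ifs at h h' <;> simp_all
    · refine List.nodup_range.imp ?_
      intro b b' hbb e h h'
      simp only [List.mem_flatMap, edgeTo] at h h'
      obtain ⟨c, -, h⟩ := h
      obtain ⟨d, -, h'⟩ := h'
      split_ifs at h h' <;> simp_all
  have h₃ : ((List.range (12 * A)).map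
      fun x => (2 * A + x / (4 * A), 2 * A + 3 + x)).Nodup := by
    refine List.Nodup.map_on (fun x _ y _ h => ?_) List.nodup_range
    simp only [Prod.mk.injEq] at h
    omega
  have h₄ : ((List.range (6 * M)).map
      fun x => (chainBase A + x, chainBase A + x + M + M)).Nodup := by
    refine List.Nodup.map_on (fun x _ y _ h => ?_) List.nodup_range
    simp only [Prod.mk.injEq] at h
    omega
  -- The tails of the edges of the four kinds lie in disjoint intervals.
  have m₁ : ∀ e ∈ (List.range A).flatMap (edgesFrom A M u), e.1 < A := by
    intro e he
    simp only [List.mem_flatMap, List.mem_range, edgesFrom, List.mem_append, List.mem_cons,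
      List.mem_map, List.not_mem_nil] at he
    obtain ⟨a, ha, (rfl | rfl | rfl | h) | ⟨c, -, rfl⟩⟩ := he <;> first | exact ha | exact h.elim
  have m₂ : ∀ e ∈ (List.range A).flatMap
      (fun b => (List.range M).flatMap (edgeTo A M v b)), chainBase A + 6 * M ≤ e.1 := by
    intro e he
    simp only [List.mem_flatMap, edgeTo] at he
    obtain ⟨b, -, c, -, he⟩ := he
    split_ifs at he
    · simp at he
    · rw [List.mem_singleton] at he
      subst he
      simp only
      omega
  have m₃ : ∀ e ∈ (List.range (12 * A)).map
      (fun x => (2 * A + x / (4 * A), 2 * A + 3 + x)), 2 * A ≤ e.1 ∧ e.1 < 2 * A + 3 := by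
    intro e he
    simp only [List.mem_map, List.mem_range] at he
    obtain ⟨x, hx, rfl⟩ := he
    have hd : x / (4 * A) < 3 := by rw [Nat.div_lt_iff_lt_mul (by omega)]; omega
    exact ⟨Nat.le_add_right _ _, Nat.add_lt_add_left hd _⟩
  have m₄ : ∀ e ∈ (List.range (6 * M)).map
      (fun x => (chainBase A + x, chainBase A + x + M + M)),
      chainBase A ≤ e.1 ∧ e.1 < chainBase A + 6 * M := by
    intro e he
    simp only [List.mem_map, List.mem_range] at he
    obtain ⟨x, hx, rfl⟩ := he
    simp only
    omega
  rw [graphEdges, List.nodup_append, List.nodup_append, List.nodup_append]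
  refine ⟨⟨⟨h₁, h₂, ?_⟩, h₃, ?_⟩, h₄, ?_⟩
  · rintro e he _ he' rfl
    have := m₁ e he
    have := m₂ e he'
    omega
  · rintro e he _ he' rfl
    have := m₃ e he'
    rcases List.mem_append.1 he with he | he
    · have := m₁ e he
      omega
    · have := m₂ e he
      omega
  · rintro e he _ he' rfl
    have := m₄ e he'
    rcases List.mem_append.1 he with he | he
    · rcases List.mem_append.1 he with he | he
      · have := m₁ e he
        omega
      · have := m₂ e he
        omega
    · have := m₃ e he
      omega

theorem lt_of_mem_graphEdges {A M : ℕ} {u v : ℕ → ℕ → ℕ} (hu : ∀ a c, u a c ≤ 1) {x y : ℕ}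
    (h : (x, y) ∈ graphEdges A M u v) :
    x < chainBase A + 8 * M ∧ y < chainBase A + 8 * M := by
  have hX : chainBase A = 14 * A + 3 := rfl
  rw [mem_graphEdges] at h
  rcases h with ⟨hx, h₁, h₂⟩ | ⟨hx, c, hc, rfl⟩ | ⟨b, hb, c, hc, -, rfl, rfl⟩ |
    ⟨q, hq, i, hi, -, rfl, rfl⟩ | ⟨i, hi, rfl, rfl⟩
  · omega
  · have := hu x c
    omega
  all_goals omega

/-! ### Formulas and pairs of half assignments -/

/-- The clauses of a formula as lists of literals. -/
def clauseCodes {N : ℕ} (φ : List (SatClause N)) : List (List ℕ) :=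
  φ.map fun C => C.map fun l => 2 * (l.1 : ℕ) + l.2.toNat

theorem encodeFormula_eq {N : ℕ} (φ : List (SatClause N)) :
    encodeFormula φ = RAM.formulaWord N (clauseCodes φ) := by
  simp [encodeFormula, RAM.formulaWord, clauseCodes, RAM.clauseWord, List.flatMap_map]

theorem litTable_ne_zero_iff {off H a i : ℕ} {b : Bool} :
    RAM.litTable off H a (2 * i + b.toNat) ≠ 0 ↔
      off ≤ i ∧ i < off + H ∧ a.testBit (i - off) = b := by
  have h₁ : (2 * i + b.toNat) / 2 = i := by cases b <;> simp; omega
  have h₂ : (2 * i + b.toNat) % 2 = b.toNat := by cases b <;> simp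
  have h₃ : a / 2 ^ (i - off) % 2 = b.toNat ↔ a.testBit (i - off) = b := by
    rw [Nat.testBit_eq_decide_div_mod_eq]
    cases b <;> simp
  rw [RAM.litTable, h₁, h₂, ← h₃]
  simp

theorem falsified_eq_zero_iff {tab : ℕ → ℕ} {C : List ℕ} :
    RAM.falsified tab C = 0 ↔ ∃ l ∈ C, tab l ≠ 0 := by
  rw [RAM.falsified]
  simp

/-- The pair `a`, `b` of half assignments does not falsify the same clause twice if and only if the
assignment that it forms is satisfying. -/
theorem forall_mul_eq_zero_iff {N H : ℕ} (hN : N ≤ 2 * H) (φ : List (SatClause N)) (a b : ℕ) :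
    (∀ c < (clauseCodes φ).length,
      falsifiedFst H (clauseCodes φ) a c * falsifiedSnd H (clauseCodes φ) b c = 0) ↔
      ∀ C ∈ φ, ∃ l ∈ C,
        (if (l.1 : ℕ) < H then a.testBit l.1 else b.testBit (l.1 - H)) = l.2 := by
  rw [List.forall_mem_iff_forall_getElem]
  simp only [clauseCodes, List.length_map]
  refine forall_congr' fun c => forall_congr' fun hc => ?_
  rw [falsifiedFst, falsifiedSnd, List.getD_eq_getElem _ _ (by simpa using hc), mul_eq_zero,
    falsified_eq_zero_iff, falsified_eq_zero_iff, List.getElem_map]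
  simp only [List.mem_map, exists_exists_and_eq_and, litTable_ne_zero_iff]
  rw [← exists_or]
  refine exists_congr fun l => ?_
  rw [← and_or_left]
  refine and_congr_right fun _ => ?_
  have := l.1.isLt
  split_ifs with h
  · simp [h]
  · simp [h, not_lt.1 h, show (l.1 : ℕ) < H + H by omega]

theorem isSatisfiable_of_forall_mul_eq_zero {N H a b : ℕ} (hN : N ≤ 2 * H)
    {φ : List (SatClause N)} (h : ∀ c < (clauseCodes φ).length,
      falsifiedFst H (clauseCodes φ) a c * falsifiedSnd H (clauseCodes φ) b c = 0) :
    IsSatisfiable φ :=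
  ⟨fun i => if (i : ℕ) < H then a.testBit i else b.testBit (i - H),
    (forall_mul_eq_zero_iff hN φ a b).1 h⟩

theorem IsSatisfiable.exists_forall_mul_eq_zero {N H : ℕ} (hN : N ≤ 2 * H)
    {φ : List (SatClause N)} (h : IsSatisfiable φ) :
    ∃ a < 2 ^ H, ∃ b < 2 ^ H, ∀ c < (clauseCodes φ).length,
      falsifiedFst H (clauseCodes φ) a c * falsifiedSnd H (clauseCodes φ) b c = 0 := by
  obtain ⟨x, hx⟩ := h
  let bit : ℕ → Bool := fun i => if h : i < N then x ⟨i, h⟩ else false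
  refine ⟨Nat.ofBits fun i : Fin H => bit i, Nat.ofBits_lt_two_pow _,
    Nat.ofBits fun i : Fin H => bit (H + i), Nat.ofBits_lt_two_pow _,
    (forall_mul_eq_zero_iff hN φ _ _).2 ?_⟩
  intro C hC
  obtain ⟨l, hl, hxl⟩ := hx C hC
  refine ⟨l, hl, ?_⟩
  have hlt := l.1.isLt
  split_ifs with h
  · rw [Nat.testBit_ofBits_lt _ _ h]
    simpa [bit] using hxl
  · rw [Nat.testBit_ofBits_lt _ _ (by omega)]
    simpa [bit, Nat.add_sub_cancel' (not_lt.1 h)] using hxl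

theorem length_le_of_isKCNF {N k : ℕ} {φ : List (SatClause N)} (h : IsKCNF k φ) :
    φ.length ≤ (2 * N + 1) ^ k := by
  -- A clause with at most `k` literals is determined by its first `k` entries.
  have hnd : (φ.map fun (C : SatClause N) (i : Fin k) => C[(i : ℕ)]?).Nodup := by
    refine List.Nodup.map_on (fun C hC D hD hCD => ?_) h.1
    refine List.ext_getElem? fun i => ?_
    by_cases hi : i < k
    · exact congrFun hCD ⟨i, hi⟩
    · rw [List.getElem?_eq_none ((h.2 C hC).trans (not_lt.1 hi)),
        List.getElem?_eq_none ((h.2 D hD).trans (not_lt.1 hi))]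
  have := hnd.length_le_card
  simpa [mul_comm] using this

theorem length_le_of_mem_clauseCodes {N k : ℕ} {φ : List (SatClause N)} (h : IsKCNF k φ) :
    ∀ C ∈ clauseCodes φ, C.length ≤ k := by
  intro C hC
  simp only [clauseCodes, List.mem_map] at hC
  obtain ⟨D, hD, rfl⟩ := hC
  simpa using h.2 D hD

theorem length_formulaWord_le {N k : ℕ} {cs : List (List ℕ)} (h : ∀ C ∈ cs, C.length ≤ k) :
    (RAM.formulaWord N cs).length ≤ cs.length * (k + 1) + 2 := by
  have : (cs.flatMap RAM.clauseWord).length ≤ cs.length * (k + 1) := by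
    induction cs with
    | nil => simp
    | cons C cs ih =>
      rw [List.flatMap_cons, List.length_append, List.length_cons, Nat.succ_mul]
      have h₁ := ih fun C hC => h C (List.mem_cons_of_mem _ hC)
      have h₂ := h C List.mem_cons_self
      simp only [RAM.clauseWord, List.length_cons]
      omega
  simpa [RAM.formulaWord] using this

theorem getD_formulaWord_le {N W H D A : ℕ} {φ : List (SatClause N)} (hN : N ≤ 2 * H)
    (hW : RAM.maxNumber N H A D (clauseCodes φ) ≤ W) (i : ℕ) :
    (RAM.formulaWord N (clauseCodes φ)).getD i 0 ≤ W := by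
  have hb := RAM.maxNumber_bounds N H A D (clauseCodes φ)
  have hlen : (RAM.formulaWord N (clauseCodes φ)).length =
    ((clauseCodes φ).flatMap RAM.clauseWord).length + 2 := rfl
  rcases lt_or_ge i (RAM.formulaWord N (clauseCodes φ)).length with hi | hi
  · rw [List.getD_eq_getElem _ _ hi]
    have hmem := List.getElem_mem hi
    generalize (RAM.formulaWord N (clauseCodes φ))[i] = x at hmem
    rw [RAM.formulaWord, List.mem_cons, List.mem_cons, List.mem_flatMap] at hmem
    rcases hmem with rfl | rfl | ⟨C, hC, hx⟩
    · omega
    · omega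
    · rw [RAM.clauseWord, List.mem_cons] at hx
      rcases hx with rfl | hx
      · have : (RAM.clauseWord C).length ≤ ((clauseCodes φ).flatMap RAM.clauseWord).length := by
          rw [List.length_flatMap]
          exact List.single_le_sum (by simp) _ (List.mem_map_of_mem hC)
        rw [RAM.clauseWord, List.length_cons] at this
        omega
      · simp only [clauseCodes, List.mem_map] at hC
        obtain ⟨D, -, rfl⟩ := hC
        rw [List.mem_map] at hx
        obtain ⟨l, -, rfl⟩ := hx
        have := l.1.isLt
        have : l.2.toNat ≤ 1 := Bool.toNat_le _
        omega
  · rw [List.getD_eq_default _ _ hi]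
    exact Nat.zero_le _

/-! ### The program that decides satisfiability -/

namespace RAM

/-- Decide satisfiability with the help of a program `p` that finds a most central vertex: write the
graph, run `p` on it, and try to extend the half assignment that `p` returns. -/
def decideSat (D : ℕ) (p : Prog) : Prog :=
  buildGraph D ;; p.shift ownRegs ownArrs ;; .op .div rSrc ownRegs rOne ;; tryAll

set_option maxRecDepth 4000 in
theorem buildGraph_regs (D : ℕ) : ∀ r ∈ (buildGraph D).regs, r < ownRegs :=
  show ∀ r ∈ (buildGraph 0).regs, r < ownRegs by decide

set_option maxRecDepth 4000 in
theorem buildGraph_arrs (D : ℕ) : ∀ j ∈ (buildGraph D).arrs, j ≤ ownArrs :=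
  show ∀ j ∈ (buildGraph 0).arrs, j ≤ ownArrs by decide

/-- After the graph is written, the part of the machine that is reserved for the subroutine is in
the initial state on the graph. -/
theorem eq_graft_init {D : ℕ} {w g : List ℕ} {s : State}
    (hf : Frame (buildGraph D) (init w) s) (hg : ∀ i, s.mem ownArrs i = g.getD i 0) :
    s = State.graft ownRegs ownArrs s (init g) := by
  ext r i
  · rw [State.graft]
    by_cases h : r < ownRegs
    · simp only [if_pos h]
    · simp only [if_neg h]
      exact hf.reg r fun h' => h (buildGraph_regs D r h')
  · rw [State.graft]
    by_cases h : r < ownArrs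
    · simp only [if_pos h]
    · simp only [if_neg h]
      rcases (not_lt.1 h).eq_or_lt with rfl | h'
      · rw [hg]; simp [init]
      · rw [hf.mem r fun h'' => absurd (buildGraph_arrs D r h'') (by omega)]
        simp [init, show r ≠ 0 by omega, show r - ownArrs ≠ 0 by omega]

end RAM

/-- The edges of the graph of a formula. -/
def formulaEdges (H : ℕ) (cs : List (List ℕ)) : List (ℕ × ℕ) :=
  graphEdges (2 ^ H) cs.length (falsifiedFst H cs) (falsifiedSnd H cs)

/-- The number of elementary steps that `RAM.decideSat` takes outside of the subroutine. -/
def stepCount (H M k : ℕ) : ℕ :=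
  (2 ^ H * (H * 26 + M * (16 * k + 37) + 209) + H * 4 + 60 * M + 42) +
    (2 ^ H * (H * 13 + M * (16 * k + 21) + 14) + H * 13 + 8) + 1

theorem exists_edgeList {n : ℕ} (es : List (ℕ × ℕ)) (h : ∀ e ∈ es, e.1 < n ∧ e.2 < n) :
    ∃ E : List (Fin n × Fin n), E.map (fun e => ((e.1 : ℕ), (e.2 : ℕ))) = es := by
  induction es with
  | nil => exact ⟨[], rfl⟩
  | cons e es ih =>
    obtain ⟨E, hE⟩ := ih fun e he => h e (List.mem_cons_of_mem _ he)
    obtain ⟨h₁, h₂⟩ := h e List.mem_cons_self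
    exact ⟨(⟨e.1, h₁⟩, ⟨e.2, h₂⟩) :: E, by simp [hE]⟩

/-- The program decides satisfiability. Its time is that of the subroutine on the graph of the
formula, which `B` bounds, plus that of the elementary steps outside. -/
theorem exec_decideSat {p : RAM.Prog} {D k N H : ℕ} {B : ℕ → ℕ → ℝ} {φ : List (SatClause N)}
    (hp : ∀ (n : ℕ) (G : Digraph (Fin n)) (E : List (Fin n × Fin n)),
      0 < n → (∀ v, ¬ G.Adj v v) → G.IsEdgeList E → E.length * D ≤ n →
      ∃ (s : RAM.State) (t : ℕ), RAM.Exec p (RAM.init (encodeDigraph E)) s t ∧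
        (∃ v : Fin n, s.reg 0 = (v : ℕ) ∧ G.IsMostCentral v) ∧ (t : ℝ) ≤ B n E.length)
    (hφ : IsKCNF k φ) (hH : (N + 1) / 2 = H) :
    ∃ (s : RAM.State) (t : ℕ), RAM.Exec (RAM.decideSat D p) (RAM.init (encodeFormula φ)) s t ∧
      (IsSatisfiable φ → s.reg 0 = 1) ∧ (¬ IsSatisfiable φ → s.reg 0 = 0) ∧
      (t : ℝ) ≤ ((stepCount H φ.length k *
        (1 + 2 * Nat.size (RAM.maxNumber N H (2 ^ H) D (clauseCodes φ))) : ℕ) : ℝ) +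
        B (RAM.numVertices D (2 ^ H) φ.length (formulaEdges H (clauseCodes φ)).length)
          (formulaEdges H (clauseCodes φ)).length := by
  have hN : N ≤ 2 * H := by omega
  have hk := length_le_of_mem_clauseCodes hφ
  have hM : (clauseCodes φ).length = φ.length := List.length_map _
  rw [encodeFormula_eq, ← hM]
  set cs := clauseCodes φ with hcs
  set W := RAM.maxNumber N H (2 ^ H) D cs with hW
  set A := 2 ^ H with hA
  set es := formulaEdges H cs with hes
  set n := RAM.numVertices D A cs.length es.length with hn
  have hWb := RAM.maxNumber_bounds N H A D cs
  have hlen := length_graphEdges_le A cs.length (falsifiedFst H cs) (falsifiedSnd H cs)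
  change es.length ≤ _ at hlen
  have hlenD := Nat.mul_le_mul_left D hlen
  have hX : chainBase A = 14 * A + 3 := rfl
  have hu : ∀ a c, falsifiedFst H cs a c ≤ 1 := fun a c => RAM.falsified_le _ _
  have hnX : chainBase A + 8 * cs.length ≤ n := Nat.le_add_right _ _
  have hnW : n ≤ W := by
    rw [hn, RAM.numVertices, mul_comm es.length]; omega
  have hW0 : RAM.maxNumber N H A 0 cs ≤ W := by
    rw [hW, RAM.maxNumber, RAM.maxNumber, Nat.add_mul, Nat.add_mul]; omega
  have hb₀ : RAM.Bounded W (RAM.init (RAM.formulaWord N cs)) := by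
    refine ⟨fun _ _ => Nat.zero_le _, fun j _ i => ?_⟩
    rw [RAM.init]
    by_cases hj : j = 0
    · simp only [if_pos hj]
      exact getD_formulaWord_le hN le_rfl i
    · simp only [if_neg hj]
      exact Nat.zero_le _
  obtain ⟨s₁, t₁, hex₁, hb₁, ht₁, ⟨hctx, he₁, he₂, hword⟩, hf₁⟩ :=
    (RAM.runs_buildGraph hk hH le_rfl).frame hb₀
  obtain ⟨E, hE⟩ := exists_edgeList (n := n) es fun e he => by
    have := lt_of_mem_graphEdges (A := A) hu (x := e.1) (y := e.2) he
    omega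
  have hElen : E.length = es.length := by rw [← hE, List.length_map]
  let G : Digraph (Fin n) := ⟨fun x y => ((x : ℕ), (y : ℕ)) ∈ es⟩
  have hG : ∀ x y : Fin n, G.Adj x y ↔ ((x : ℕ), (y : ℕ)) ∈
      graphEdges A cs.length (falsifiedFst H cs) (falsifiedSnd H cs) := fun _ _ => Iff.rfl
  have hEG : G.IsEdgeList E := by
    have hinj : Function.Injective fun e : Fin n × Fin n => ((e.1 : ℕ), (e.2 : ℕ)) := by
      rintro ⟨a, b⟩ ⟨c, d⟩ h
      simpa [Fin.ext_iff] using h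
    refine ⟨List.Nodup.of_map _ (by rw [hE]; exact nodup_graphEdges hu), fun x y => ?_⟩
    change _ ↔ ((x : ℕ), (y : ℕ)) ∈ es
    rw [← hE]
    exact (List.mem_map_of_injective hinj).symm
  have hloop : ∀ x, ¬ G.Adj x x := fun x h => by
    have := layer_eq_of_mem_graphEdges hu ((hG x x).1 h)
    omega
  have henc : encodeDigraph E = RAM.graphWord D A cs es := by
    have : RAM.pairWord es = E.flatMap fun e => [(e.1 : ℕ), (e.2 : ℕ)] := by
      rw [← hE, RAM.pairWord, List.flatMap_map]
    rw [encodeDigraph, RAM.graphWord, hElen, this]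
  obtain ⟨s₂, t₂, hex₂, ⟨x, hx, hcentral⟩, ht₂⟩ := hp n G E (by omega) hloop hEG (by
    rw [hElen, hn, RAM.numVertices]; omega)
  rw [henc] at hex₂
  rw [hElen] at ht₂
  have hex₂' := hex₂.shift RAM.ownRegs RAM.ownArrs s₁
  rw [← RAM.eq_graft_init (g := RAM.graphWord D A cs es) hf₁ hword] at hex₂'
  set s₃ := RAM.State.graft RAM.ownRegs RAM.ownArrs s₁ s₂ with hs₃
  have hreg₃ : ∀ r < RAM.ownRegs, s₃.reg r = s₁.reg r := fun r hr => if_pos hr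
  have hmem₃ : ∀ j < RAM.ownArrs, s₃.mem j = s₁.mem j := fun j hj => if_pos hj
  have hx₃ : s₃.reg RAM.ownRegs = x := (RAM.State.graft_reg _ _ s₁ s₂ 0).trans hx
  have hctx₃ : RAM.Ctx N H A cs s₃ :=
    hctx.congr (fun r hr => hreg₃ r (by revert r; decide)) (hmem₃ 0 (by decide))
  have hb₃ : RAM.Bounded W s₃ :=
    ⟨fun r hr => (hreg₃ r hr).trans_le (hb₁.reg r hr),
      fun j hj i => by rw [hmem₃ j hj]; exact hb₁.mem j hj i⟩
  have hxW : (x : ℕ) ≤ W := x.isLt.le.trans hnW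
  have hex₄ := RAM.Exec.op s₃ .div RAM.rSrc RAM.ownRegs RAM.rOne
  rw [hctx₃.one, hx₃, RAM.Op.eval, Nat.div_one] at hex₄
  obtain ⟨s₅, t₅, hex₅, -, ht₅, hans⟩ := RAM.runs_tryAll (a := x) (hctx₃.setReg RAM.rSrc x)
    (fun l hl => by rw [RAM.State.mem_setReg, hmem₃ 1 (by decide), he₁ l hl])
    (fun l hl => by rw [RAM.State.mem_setReg, hmem₃ 2 (by decide), he₂ l hl])
    (by simp) hxW hk hW0 (hb₃.setReg RAM.rSrc hxW)
  refine ⟨s₅, _, .seq hex₁ (.seq hex₂' (.seq hex₄ hex₅)), fun hsat => ?_, fun hsat => ?_, ?_⟩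
  · obtain ⟨-, hx'⟩ := exists_of_isMostCentral hu hnX hG (hsat.exists_forall_mul_eq_zero hN)
      hcentral
    exact hans.trans (if_pos hx')
  · exact hans.trans (if_neg fun ⟨b, _, h⟩ => hsat (isSatisfiable_of_forall_mul_eq_zero hN h))
  · have hsize := Nat.size_le_size hxW
    have : (1 + Nat.size x + Nat.size 1) ≤ 1 + 2 * Nat.size W := by
      have := Nat.size_le_size (show 1 ≤ W by omega)
      omega
    have hsum : t₁ + (1 + Nat.size x + Nat.size 1) + t₅ ≤
        stepCount H cs.length k * (1 + 2 * Nat.size W) := by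
      refine (Nat.add_le_add (Nat.add_le_add ht₁ this) ht₅).trans (le_of_eq ?_)
      rw [stepCount]
      ring
    have hsum' : ((t₁ + (1 + Nat.size x + Nat.size 1) + t₅ : ℕ) : ℝ) ≤
        ((stepCount H cs.length k * (1 + 2 * Nat.size W) : ℕ) : ℝ) := by exact_mod_cast hsum
    push_cast at hsum' ht₂ ⊢
    linarith

/-! ### The running time -/

theorem graph_size_le (D A M : ℕ) (hA : 1 ≤ A) {m : ℕ}
    (hm : m ≤ 15 * A + 2 * (A * M) + 6 * M) :
    RAM.numVertices D A M m + m ≤ (32 + 15 * D) * (A * (M + 1)) := by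
  have hAM : M ≤ A * M := Nat.le_mul_of_pos_left _ hA
  have hm' : m ≤ 15 * (A * (M + 1)) := by rw [Nat.mul_add]; omega
  have h := Nat.mul_le_mul_right D hm'
  have e : (32 + 15 * D) * (A * (M + 1)) = 32 * (A * (M + 1)) + 15 * (A * (M + 1)) * D := by ring
  rw [RAM.numVertices, chainBase, e]
  rw [Nat.mul_add] at hm' ⊢
  rw [Nat.mul_add] at h
  omega

/-- The steps outside of the subroutine cost `O(2 ^ H * Z ^ 2)`, if `Z` bounds the numbers of
variables and of clauses. -/
theorem stepCount_mul_le {N H M k D Z : ℕ} {cs : List (List ℕ)} (hk : ∀ C ∈ cs, C.length ≤ k)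
    (hcs : cs.length = M) (hH : H ≤ Z) (hN : N ≤ Z) (hM : M ≤ Z) (hZ : 1 ≤ Z) :
    stepCount H M k * (1 + 2 * Nat.size (RAM.maxNumber N H (2 ^ H) D cs)) ≤
      ((32 * k + 600) * (2 * k + 50 * D + 250)) * (2 ^ H * Z ^ 2) := by
  subst hcs
  have hA : 1 ≤ 2 ^ H := Nat.one_le_two_pow
  have hMk : cs.length * k ≤ Z * k := Nat.mul_le_mul_right _ hM
  have h₁ : stepCount H cs.length k ≤ 2 ^ H * ((32 * k + 600) * Z) := by
    have e : stepCount H cs.length k = 2 ^ H * (39 * H + 32 * (cs.length * k) + 58 * cs.length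
        + 223) + (17 * H + 60 * cs.length + 51) := by rw [stepCount]; ring
    have h₂ : 17 * H + 60 * cs.length + 51 ≤ 2 ^ H * (17 * H + 60 * cs.length + 51) :=
      Nat.le_mul_of_pos_left _ hA
    calc stepCount H cs.length k
        ≤ 2 ^ H * (39 * H + 32 * (cs.length * k) + 58 * cs.length + 223) +
          2 ^ H * (17 * H + 60 * cs.length + 51) := by omega
      _ = 2 ^ H * (56 * H + 32 * (cs.length * k) + 118 * cs.length + 274) := by ring
      _ ≤ 2 ^ H * ((32 * k + 600) * Z) := by
        refine Nat.mul_le_mul_left _ ?_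
        rw [Nat.add_mul, mul_assoc, mul_comm k]
        omega
  have h₂ : Nat.size (RAM.maxNumber N H (2 ^ H) D cs) ≤ (k + 24 * D + 100) * Z := by
    set R := cs.length * (k + 1) + 4 * H + (D + 2) * (15 + 8 * cs.length) + 8 * cs.length + D + N
      + 36 with hR
    have h₃ : RAM.maxNumber N H (2 ^ H) D cs ≤ 2 ^ H * R := by
      have hw := length_formulaWord_le (N := N) hk
      have h₄ : cs.length ≤ 2 ^ H * cs.length := Nat.le_mul_of_pos_left _ hA
      have h₅ : (D + 2) * (15 * 2 ^ H + 2 * (2 ^ H * cs.length) + 6 * cs.length) ≤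
          2 ^ H * ((D + 2) * (15 + 8 * cs.length)) := by
        calc (D + 2) * (15 * 2 ^ H + 2 * (2 ^ H * cs.length) + 6 * cs.length)
            ≤ (D + 2) * (15 * 2 ^ H + 8 * (2 ^ H * cs.length)) :=
              Nat.mul_le_mul_left _ (by omega)
          _ = 2 ^ H * ((D + 2) * (15 + 8 * cs.length)) := by ring
      have h₆ : cs.length * (k + 1) + 4 * H + 8 * cs.length + D + N + 22 ≤
          2 ^ H * (cs.length * (k + 1) + 4 * H + 8 * cs.length + D + N + 22) :=
        Nat.le_mul_of_pos_left _ hA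
      calc RAM.maxNumber N H (2 ^ H) D cs
          ≤ 2 ^ H * (cs.length * (k + 1) + 4 * H + 8 * cs.length + D + N + 22) +
            2 ^ H * ((D + 2) * (15 + 8 * cs.length)) + 14 * 2 ^ H := by
            rw [RAM.maxNumber]; omega
        _ = 2 ^ H * R := by rw [hR]; ring
    have h₄ : Nat.size (RAM.maxNumber N H (2 ^ H) D cs) ≤ H + R := by
      rw [Nat.size_le, pow_add]
      exact h₃.trans_lt (Nat.mul_lt_mul_of_pos_left Nat.lt_two_pow_self hA)
    refine h₄.trans ?_
    have hD : D * cs.length ≤ D * Z := Nat.mul_le_mul_left _ hM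
    have hD' : D ≤ D * Z := Nat.le_mul_of_pos_right _ hZ
    have e₁ : H + R = 5 * H + cs.length * k + 25 * cs.length + 8 * (D * cs.length) + 16 * D + N
      + 66 := by rw [hR]; ring
    have e₂ : (k + 24 * D + 100) * Z = Z * k + 24 * (D * Z) + 100 * Z := by ring
    omega
  calc stepCount H cs.length k * (1 + 2 * Nat.size (RAM.maxNumber N H (2 ^ H) D cs))
      ≤ 2 ^ H * ((32 * k + 600) * Z) * ((2 * k + 50 * D + 250) * Z) := by
        refine Nat.mul_le_mul h₁ ?_
        have : (2 * k + 50 * D + 250) * Z =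
            2 * ((k + 24 * D + 100) * Z) + 2 * (D * Z) + 50 * Z := by ring
        omega
    _ = _ := by ring

/-- A polynomial factor does not matter next to a change of the base of an exponential. -/
theorem exists_pow_mul_pow_le (q : ℕ) {r ρ : ℝ} (hr : 0 < r) (hρ : r < ρ) :
    ∃ B : ℝ, ∀ N : ℕ, (2 * (N : ℝ) + 2) ^ q * r ^ N ≤ B * ρ ^ N := by
  have hρ0 : 0 < ρ := hr.trans hρ
  have hx0 : 0 < r / ρ := div_pos hr hρ0
  have hx : |r / ρ| < 1 := by rwa [abs_of_pos hx0, div_lt_one hρ0]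
  obtain ⟨B, hB⟩ := (tendsto_pow_const_mul_const_pow_of_abs_lt_one q hx).bddAbove_range
  refine ⟨2 ^ q * B / (r / ρ), fun N => ?_⟩
  have h : ((N + 1 : ℕ) : ℝ) ^ q * (r / ρ) ^ (N + 1) ≤ B := hB ⟨N + 1, rfl⟩
  have e : (2 * (N : ℝ) + 2) ^ q * r ^ N =
      2 ^ q * (((N + 1 : ℕ) : ℝ) ^ q * (r / ρ) ^ (N + 1)) / (r / ρ) * ρ ^ N := by
    rw [show 2 * (N : ℝ) + 2 = 2 * ((N + 1 : ℕ) : ℝ) by push_cast; ring, mul_pow, pow_succ (r / ρ),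
      div_pow]
    field_simp
  rw [e]
  gcongr

/-- The number of half assignments is `O(2 ^ (N / 2))`, here raised to the power `a`. -/
theorem two_pow_half_rpow_le {a : ℝ} (ha : 0 ≤ a) (ha2 : a ≤ 2) (N : ℕ) :
    ((2 ^ ((N + 1) / 2) : ℕ) : ℝ) ^ a ≤ 2 * ((2 : ℝ) ^ (a / 2)) ^ N := by
  have h : (((N + 1) / 2 : ℕ) : ℝ) ≤ ((N : ℝ) + 1) / 2 := by
    have := Nat.cast_div_le (α := ℝ) (m := N + 1) (n := 2)
    push_cast at this ⊢
    exact this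
  calc ((2 ^ ((N + 1) / 2) : ℕ) : ℝ) ^ a = (2 : ℝ) ^ ((((N + 1) / 2 : ℕ) : ℝ) * a) := by
        rw [Real.rpow_mul (by norm_num), Real.rpow_natCast]; push_cast; rfl
    _ ≤ (2 : ℝ) ^ (a / 2 + a / 2 * N) := by
        refine Real.rpow_le_rpow_of_exponent_le (by norm_num) ?_
        nlinarith
    _ = (2 : ℝ) ^ (a / 2) * ((2 : ℝ) ^ (a / 2)) ^ N := by
        rw [Real.rpow_add (by norm_num), Real.rpow_mul (by norm_num), Real.rpow_natCast]
    _ ≤ 2 * ((2 : ℝ) ^ (a / 2)) ^ N := by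
        gcongr
        calc (2 : ℝ) ^ (a / 2) ≤ (2 : ℝ) ^ (1 : ℝ) :=
              Real.rpow_le_rpow_of_exponent_le (by norm_num) (by linarith)
          _ = 2 := Real.rpow_one 2

/-- Finding a most central vertex of sparse graphs in time `O((n + m) ^ (2 - ε))`, where
`2 - ε ≤ a` and `1 ≤ a`, decides `k`-satisfiability in time `O(ρ ^ N)` if `ρ > 2 ^ (a / 2)`. -/
theorem kSatDecidableInTime_of_mostCentral {c ε a ρ : ℝ} (hc : 0 < c)
    (h : MostCentralComputableInTime (fun n m => (m : ℝ) ≤ c * (n : ℝ)) (2 - ε))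
    (ha1 : 1 ≤ a) (ha2 : a ≤ 2) (ha : 2 - ε ≤ a) (hρ : (2 : ℝ) ^ (a / 2) < ρ) (k : ℕ) :
    KSatDecidableInTime k fun N => ρ ^ N := by
  obtain ⟨p, K, hp⟩ := h
  -- With `m * D` isolated vertices, there are at most `c * n` edges.
  obtain ⟨D, hD⟩ := exists_nat_ge (1 / c)
  rw [div_le_iff₀ hc] at hD
  obtain ⟨B, hB⟩ := exists_pow_mul_pow_le (2 * (k + 1)) (Real.rpow_pos_of_pos two_pos (a / 2)) hρ
  obtain ⟨C₁, hC₁⟩ : ∃ C : ℕ, C = (32 * k + 600) * (2 * k + 50 * D + 250) := ⟨_, rfl⟩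
  obtain ⟨C₂, hC₂⟩ : ∃ C : ℕ, C = (32 + 15 * D) * 2 := ⟨_, rfl⟩
  refine ⟨RAM.decideSat D p, ((C₁ : ℝ) + |K| * (C₂ : ℝ) ^ 2) * (2 * B), fun N φ hφ => ?_⟩
  have hp' : ∀ (n : ℕ) (G : Digraph (Fin n)) (E : List (Fin n × Fin n)),
      0 < n → (∀ v, ¬ G.Adj v v) → G.IsEdgeList E → E.length * D ≤ n →
      ∃ (s : RAM.State) (t : ℕ), RAM.Exec p (RAM.init (encodeDigraph E)) s t ∧
        (∃ v : Fin n, s.reg 0 = (v : ℕ) ∧ G.IsMostCentral v) ∧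
        (t : ℝ) ≤ K * ((n : ℝ) + (E.length : ℝ)) ^ (2 - ε) := by
    intro n G E hn hG hE hED
    refine hp n G E hn hG hE ?_
    have : (E.length : ℝ) * D ≤ n := by exact_mod_cast hED
    nlinarith [(Nat.cast_nonneg E.length : (0 : ℝ) ≤ _)]
  obtain ⟨s, t, hex, h1, h0, ht⟩ := exec_decideSat
    (B := fun n m => K * ((n : ℝ) + (m : ℝ)) ^ (2 - ε)) hp' hφ (rfl : (N + 1) / 2 = _)
  refine ⟨s, t, hex, h1, h0, ht.trans ?_⟩
  set H := (N + 1) / 2 with hH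
  set M := φ.length with hM
  set Z := (2 * N + 2) ^ (k + 1) with hZ
  have hcs : (clauseCodes φ).length = M := List.length_map _
  have hZN : 2 * N + 2 ≤ Z := Nat.le_self_pow (by omega) _
  have hMZ : M ≤ Z := (length_le_of_isKCNF hφ).trans
    ((Nat.pow_le_pow_left (by omega) _).trans (Nat.pow_le_pow_right (by omega) (by omega)))
  have hsteps := stepCount_mul_le (N := N) (H := H) (D := D) (Z := Z)
    (length_le_of_mem_clauseCodes hφ) hcs (by omega) (by omega) hMZ (by omega)
  rw [← hC₁] at hsteps
  have hlen : (formulaEdges H (clauseCodes φ)).length ≤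
      15 * 2 ^ H + 2 * (2 ^ H * M) + 6 * M := hcs ▸ length_graphEdges_le _ _ _ _
  have hsize := graph_size_le D (2 ^ H) M Nat.one_le_two_pow hlen
  set m := (formulaEdges H (clauseCodes φ)).length with hm
  set n := RAM.numVertices D (2 ^ H) M m with hn
  have hn1 : 1 ≤ n := by
    have : 0 < chainBase (2 ^ H) := by rw [chainBase]; omega
    rw [hn, RAM.numVertices]; omega
  have hA1 : (1 : ℝ) ≤ ((2 ^ H : ℕ) : ℝ) := by exact_mod_cast Nat.one_le_two_pow
  have hZ1 : (1 : ℝ) ≤ (Z : ℝ) := by exact_mod_cast (by omega : 1 ≤ Z)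
  have hC₂1 : (1 : ℝ) ≤ (C₂ : ℝ) := by exact_mod_cast (by omega : 1 ≤ C₂)
  have hnm : (n : ℝ) + m ≤ ((2 ^ H : ℕ) : ℝ) * (C₂ * Z) := by
    have : n + m ≤ 2 ^ H * (C₂ * Z) := by
      refine hsize.trans ?_
      calc (32 + 15 * D) * (2 ^ H * (M + 1)) ≤ (32 + 15 * D) * (2 ^ H * (2 * Z)) := by
            gcongr; omega
        _ = _ := by rw [hC₂]; ring
    exact_mod_cast this
  have hnm1 : (1 : ℝ) ≤ (n : ℝ) + m := by exact_mod_cast (by omega : 1 ≤ n + m)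
  have hpow : ((n : ℝ) + m) ^ (2 - ε) ≤ ((2 ^ H : ℕ) : ℝ) ^ a * ((C₂ : ℝ) ^ 2 * (Z : ℝ) ^ 2) := by
    calc ((n : ℝ) + m) ^ (2 - ε) ≤ ((n : ℝ) + m) ^ a := Real.rpow_le_rpow_of_exponent_le hnm1 ha
      _ ≤ (((2 ^ H : ℕ) : ℝ) * (C₂ * Z)) ^ a := by gcongr
      _ = ((2 ^ H : ℕ) : ℝ) ^ a * (C₂ * Z : ℝ) ^ a := Real.mul_rpow (by positivity) (by positivity)
      _ ≤ ((2 ^ H : ℕ) : ℝ) ^ a * (C₂ * Z : ℝ) ^ (2 : ℝ) := by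
          gcongr
          nlinarith
      _ = _ := by rw [Real.rpow_two, mul_pow]
  have hA : ((2 ^ H : ℕ) : ℝ) ≤ ((2 ^ H : ℕ) : ℝ) ^ a := by
    conv_lhs => rw [← Real.rpow_one ((2 ^ H : ℕ) : ℝ)]
    exact Real.rpow_le_rpow_of_exponent_le hA1 ha1
  have hstepsR : ((stepCount H M k *
      (1 + 2 * Nat.size (RAM.maxNumber N H (2 ^ H) D (clauseCodes φ))) : ℕ) : ℝ) ≤
      C₁ * (((2 ^ H : ℕ) : ℝ) ^ a * (Z : ℝ) ^ 2) := by
    calc _ ≤ ((C₁ * (2 ^ H * Z ^ 2) : ℕ) : ℝ) := by exact_mod_cast hsteps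
      _ = C₁ * (((2 ^ H : ℕ) : ℝ) * (Z : ℝ) ^ 2) := by push_cast; ring
      _ ≤ _ := by gcongr
  have hK : K * ((n : ℝ) + m) ^ (2 - ε) ≤
      |K| * (((2 ^ H : ℕ) : ℝ) ^ a * ((C₂ : ℝ) ^ 2 * (Z : ℝ) ^ 2)) :=
    mul_le_mul (le_abs_self K) hpow (by positivity) (abs_nonneg K)
  have hmain : ((2 ^ H : ℕ) : ℝ) ^ a * (Z : ℝ) ^ 2 ≤ 2 * B * ρ ^ N := by
    have hZe : (Z : ℝ) ^ 2 = (2 * (N : ℝ) + 2) ^ (2 * (k + 1)) := by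
      rw [hZ, mul_comm 2 (k + 1), pow_mul]; push_cast; rfl
    calc ((2 ^ H : ℕ) : ℝ) ^ a * (Z : ℝ) ^ 2
        ≤ 2 * ((2 : ℝ) ^ (a / 2)) ^ N * (Z : ℝ) ^ 2 := by
          gcongr
          exact two_pow_half_rpow_le (by linarith) ha2 N
      _ = 2 * ((2 * (N : ℝ) + 2) ^ (2 * (k + 1)) * ((2 : ℝ) ^ (a / 2)) ^ N) := by rw [hZe]; ring
      _ ≤ 2 * (B * ρ ^ N) := mul_le_mul_of_nonneg_left (hB N) two_pos.le
      _ = _ := by ring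
  calc _ ≤ C₁ * (((2 ^ H : ℕ) : ℝ) ^ a * (Z : ℝ) ^ 2) +
        |K| * (((2 ^ H : ℕ) : ℝ) ^ a * ((C₂ : ℝ) ^ 2 * (Z : ℝ) ^ 2)) := add_le_add hstepsR hK
    _ = ((C₁ : ℝ) + |K| * (C₂ : ℝ) ^ 2) * (((2 ^ H : ℕ) : ℝ) ^ a * (Z : ℝ) ^ 2) := by ring
    _ ≤ ((C₁ : ℝ) + |K| * (C₂ : ℝ) ^ 2) * (2 * B * ρ ^ N) := by gcongr
    _ = _ := by ring

theorem not_SETH_of_mostCentral_sparse {c ε : ℝ} (hc : 0 < c) (hε : 0 < ε)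
    (h : MostCentralComputableInTime (fun n m => (m : ℝ) ≤ c * (n : ℝ)) (2 - ε)) : ¬ SETH := by
  intro hS
  -- For `ε > 2` the exponent `2 - ε` is negative, so `ε` is replaced by a number up to `1`.
  set e := min ε 1 with he
  have he0 : 0 < e := lt_min hε one_pos
  have he1 : e ≤ 1 := min_le_right _ _
  have heε : e ≤ ε := min_le_left _ _
  have h1 : (1 : ℝ) < 2 ^ (1 - e / 4) := Real.one_lt_rpow (by norm_num) (by linarith)
  have h2 : (2 : ℝ) ^ (1 - e / 4) < 2 := by
    conv_rhs => rw [← Real.rpow_one 2]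
    exact Real.rpow_lt_rpow_of_exponent_lt (by norm_num) (by linarith)
  obtain ⟨k, hk⟩ := hS (2 - 2 ^ (1 - e / 4)) (by linarith) (by linarith)
  rw [sub_sub_cancel] at hk
  refine hk (kSatDecidableInTime_of_mostCentral (a := 2 - e) hc h (by linarith) (by linarith)
    (by linarith) ?_ k)
  exact Real.rpow_lt_rpow_of_exponent_lt (by norm_num) (by linarith)

theorem corollary1 :
    ((∃ ε : ℝ, 0 < ε ∧ MostCentralComputableInTime (fun _ _ => True) (2 - ε)) → ¬ SETH) ∧
    (∀ c : ℝ, 0 < c →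
      (∃ ε : ℝ, 0 < ε ∧
        MostCentralComputableInTime (fun n m => (m : ℝ) ≤ c * (n : ℝ)) (2 - ε)) → ¬ SETH) := by
  refine ⟨fun ⟨ε, hε, p, K, hp⟩ => not_SETH_of_mostCentral_sparse one_pos hε ⟨p, K, ?_⟩,
    fun c hc ⟨ε, hε, h⟩ => not_SETH_of_mostCentral_sparse hc hε h⟩
  exact fun n G E hn hG hE _ => hp n G E hn hG hE trivial
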